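/- Let $K$ be a field of characteristic $0$ (for instance $\mathbb C$) and let $t=(t_1,t_2,\dots)$. Functions of $t$ are formal power series in $K[[t]]$, $\partial=\partial/\partial t_1$, functions of $t$ and of a spectral parameter $\lambda$ are elements of $K((\lambda^{-1}))[[t]]$, and $\int d\lambda$ denotes the coefficient of $\lambda^{-1}$. Put $\xi(t,\lambda)=\sum_{n\ge1}t_n\lambda^n$ and let $$\psi(t,\lambda)=e^{\xi(t,\lambda)}\sum_{j\ge0}w_j(t)\lambda^{-j},\qquad \psi^*(t,\lambda)=e^{-\xi(t,\lambda)}\sum_{j\ge0}w^*_j(t)\lambda^{-j},\qquad w_j,w_j^*\in K[[t]],\quad w_0=w_0^*=1 .$$ Then the following two statements are equivalent. (a) There is a formal function $S(t;\lambda,\mu)=\sum_{i,j\in\mathbb Z}S_{ij}(t)\lambda^i\mu^j$, such that for every monomial in $t$ and every fixed power of one of the spectral parameters only finitely many positive powers of the other one occur, with $\partial_{t_1}S(t;\lambda,\mu)=\psi(t,\lambda)\psi^*(t,\mu)$ and, identically in two independent multi-times $t,t'$, $$\psi(t,\lambda)=-\int d\mu\,\psi(t,\mu)\,S(t';\lambda,\mu),\qquad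 \psi^*(t,\lambda)=\int d\mu\,\psi^*(t,\mu)\,S(t';\mu,\lambda).$$ (b) The Hirota bilinear identity $\int d\lambda\,\psi(t,\lambda)\,\psi^*(t',\lambda)=0$ holds identically in two independent multi-times $t,t'$. Moreover, if these hold, then $\psi,\psi^*$ are the Baker–Akhiezer and adjoint Baker–Akhiezer functions of a KP hierarchy: there is an invertible pseudo-differential operator $W=1+\sum_{n\ge1}u_n(t)D^{-n}$, $D=\partial$, such that $$\psi=W(e^{\xi}),\qquad \psi^*=(W^{*})^{-1}(e^{-\xi}),\qquad \frac{\partial W}{\partial t_n}=-(WD^nW^{-1})_-\,W\quad(n\ge1),$$ where $W^*$ is the formal adjoint and $D^{i}(e^{\pm\xi})=(\pm\lambda)^i e^{\pm\xi}$ for $i\in\mathbb Z$, and, for every $r\ge1$, the Lax operator $L=WD^rW^{-1}$, with $L^{n/r}=WD^nW^{-1}$, satisfies the Lax equations $\partial L/\partial t_n=[(L^{n/r})_+,L]$, $n\ge1$. Here $A_+$ and $A_-$ denote the parts of $A=\sum_i a_iD^i$ with $i\ge0$ and with $i<0$. -/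

import Mathlib

/-!
Formal setting.  `K` is a field of characteristic zero, the multi-time is `t = (t₁, t₂, …)`
(indexed by `ℕ+`), and functions of `t` are formal power series in `t` over `K`.  Functions of
`t` and of a spectral parameter are formal power series in `t` whose coefficients are formal
Laurent series in the inverse spectral parameter (finitely many positive powers of the parameter,
possibly infinitely many negative ones).  Functions of two multi-times `t`, `t'` are formal power
series in the variables indexed by `ℕ+ ⊕ ℕ+`.
-/

noncomputable section

namespace KPHierarchy

open MvPowerSeries

/-- Formal functions of the multi-time `t = (t₁, t₂, …)`. -/
abbrev TimeFn (K : Type*) : Type _ := MvPowerSeries ℕ+ K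

/-- Formal functions of the multi-time and of a spectral parameter `z`; the variable of the
Laurent series is `z⁻¹`. -/
abbrev SpecFn (K : Type*) [Zero K] : Type _ := MvPowerSeries ℕ+ (LaurentSeries K)

variable {K : Type*} [Field K]

/-! ### Spectral parameter -/

/-- The coefficient of the `i`-th power of the spectral parameter. -/
def specCoeff {σ : Type*} (i : ℤ) (f : MvPowerSeries σ (LaurentSeries K)) : MvPowerSeries σ K :=
  fun m => (coeff m f).coeff (-i)

/-- The spectral integral: the coefficient of the power `-1` of the spectral parameter. -/
def specIntegral {σ : Type*} (f : MvPowerSeries σ (LaurentSeries K)) : MvPowerSeries σ K :=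
  specCoeff (-1) f

/-- The family `c i` may serve as the coefficients of the powers `z ^ i`, `i : ℤ`, of the spectral
parameter: for each monomial in `t`, only finitely many positive powers of `z` occur. -/
def IsSpecBounded (c : ℤ → TimeFn K) : Prop :=
  ∀ m : ℕ+ →₀ ℕ, ∃ N : ℤ, ∀ i : ℤ, N < i → coeff m (c i) = 0

/-- The function `∑ i, c i * z ^ i` of the multi-time and the spectral parameter `z`. -/
def ofSpecCoeff (c : ℤ → TimeFn K) (hc : IsSpecBounded c) : SpecFn K :=
  fun m => HahnSeries.ofSuppBddBelow (fun k : ℤ => coeff m (c (-k))) (by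
    obtain ⟨N, hN⟩ := hc m
    refine ⟨-N, fun k hk => ?_⟩
    by_contra hlt
    exact hk (hN (-k) (by omega)))

/-- The spectral parameter, as a Laurent series in its inverse. -/
def specVar : LaurentSeries K := HahnSeries.single (-1) 1

/-- The exponential of `ε * ξ(t, z)`, where `ξ(t, z) = ∑ n ≥ 1, t n * z ^ n` and `ε = ± 1`: it is
the product over `n` of the series `exp (ε * t n * z ^ n) = ∑ j, (ε * z ^ n) ^ j / j! * (t n) ^ j`. -/
def expXi (ε : ℤˣ) : SpecFn K :=
  fun m => m.prod fun n j =>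
    HahnSeries.C ((Nat.factorial j : K)⁻¹) * ((((ε : ℤ) : LaurentSeries K)) * specVar ^ (n : ℕ)) ^ j

theorem isSpecBounded_inverse (w : ℕ → TimeFn K) :
    IsSpecBounded fun i : ℤ => if i ≤ 0 then w (-i).toNat else 0 := by
  intro m
  refine ⟨0, fun i hi => ?_⟩
  simp only [not_le.mpr hi, if_false, map_zero]

/-- The series `∑ j ≥ 0, w j * z ^ (-j)`. -/
def inverseSeries (w : ℕ → TimeFn K) : SpecFn K :=
  ofSpecCoeff (fun i : ℤ => if i ≤ 0 then w (-i).toNat else 0) (isSpecBounded_inverse w)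

/-- The function `exp (ε * ξ(t, z)) * ∑ j ≥ 0, w j t * z ^ (-j)`. -/
def waveFn (ε : ℤˣ) (w : ℕ → TimeFn K) : SpecFn K :=
  expXi ε * inverseSeries w

/-! ### Two multi-times and the Hirota identity -/

/-- `f(t)` as a function of the pair of multi-times `(t, t')`. -/
def atFirst {R : Type*} [CommRing R] (f : MvPowerSeries ℕ+ R) : MvPowerSeries (ℕ+ ⊕ ℕ+) R :=
  rename (Function.Embedding.inl : ℕ+ ↪ ℕ+ ⊕ ℕ+) f

/-- `f(t')` as a function of the pair of multi-times `(t, t')`. -/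
def atSecond {R : Type*} [CommRing R] (f : MvPowerSeries ℕ+ R) : MvPowerSeries (ℕ+ ⊕ ℕ+) R :=
  rename (Function.Embedding.inr : ℕ+ ↪ ℕ+ ⊕ ℕ+) f

/-- Hirota's bilinear identity `∫ dz ψ(t, z) ψ*(t', z) = 0`. -/
def HirotaIdentity (ψ ψs : SpecFn K) : Prop :=
  specIntegral (atFirst ψ * atSecond ψs) = 0

/-! ### Functions of two spectral parameters and the spectral identities -/

/-- A formal function `S(t; z₁, z₂) = ∑ i j, coeff i j t * z₁ ^ i * z₂ ^ j` of the multi-time and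
two spectral parameters.  For every fixed power of one of the parameters, it is a function of the
multi-time and the other parameter of the kind considered above. -/
structure BispecFn (K : Type*) [Field K] where
  /-- The coefficient of `z₁ ^ i * z₂ ^ j`. -/
  coeff : ℤ → ℤ → TimeFn K
  bounded_right : ∀ i : ℤ, IsSpecBounded fun j : ℤ => coeff i j
  bounded_left : ∀ j : ℤ, IsSpecBounded fun i : ℤ => coeff i j

/-- The coefficient of `z₁ ^ i` in `S(t; z₁, z₂)`, as a function of `t` and `z₂`. -/
def BispecFn.leftCoeff (S : BispecFn K) (i : ℤ) : SpecFn K :=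
  ofSpecCoeff (fun j => S.coeff i j) (S.bounded_right i)

/-- The coefficient of `z₂ ^ j` in `S(t; z₁, z₂)`, as a function of `t` and `z₁`. -/
def BispecFn.rightCoeff (S : BispecFn K) (j : ℤ) : SpecFn K :=
  ofSpecCoeff (fun i => S.coeff i j) (S.bounded_left j)

/-- `∂S(t; z₁, z₂)/∂t₁ = ψ(t, z₁) ψ*(t, z₂)`. -/
def IsPotential (ψ ψs : SpecFn K) (S : BispecFn K) : Prop :=
  ∀ i j : ℤ, pderiv K (1 : ℕ+) (S.coeff i j) = specCoeff i ψ * specCoeff j ψs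

/-- The identity `ψ(t, z) = - ∫ dμ ψ(t, μ) S(t'; z, μ)`, one equation for each power of `z`. -/
def SpectralIdentity (ψ : SpecFn K) (S : BispecFn K) : Prop :=
  ∀ i : ℤ, atFirst (specCoeff i ψ) = - specIntegral (atFirst ψ * atSecond (S.leftCoeff i))

/-- The identity `ψ*(t, z) = ∫ dμ ψ*(t, μ) S(t'; μ, z)`, one equation for each power of `z`. -/
def AdjointSpectralIdentity (ψs : SpecFn K) (S : BispecFn K) : Prop :=
  ∀ j : ℤ, atFirst (specCoeff j ψs) = specIntegral (atFirst ψs * atSecond (S.rightCoeff j))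

/-! ### Pseudo-differential operators in `D = ∂/∂t₁` -/

/-- Formal pseudo-differential operators `∑ i ≤ N, a i * D ^ i` with coefficients depending
on the multi-time. -/
@[ext]
structure PsiDO (K : Type*) [Field K] where
  coeff : ℤ → TimeFn K
  bounded : ∃ N : ℤ, ∀ i : ℤ, N < i → coeff i = 0

namespace PsiDO

/-- The operator `D ^ n`. -/
def D (n : ℤ) : PsiDO K where
  coeff i := if i = n then 1 else 0
  bounded := ⟨n, fun i hi => if_neg (by omega)⟩

/-- The product, determined by the generalized Leibniz rule
`D ^ i * b = ∑ l ≥ 0, (i choose l) * (∂ ^ l b) * D ^ (i - l)`. -/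
def mul (A B : PsiDO K) : PsiDO K where
  coeff n := ∑ᶠ p : ℤ × ℕ,
    Ring.choose p.1 p.2 • (A.coeff p.1 * (pderiv K (1 : ℕ+))^[p.2] (B.coeff (n - p.1 + p.2)))
  bounded := by
    obtain ⟨N, hN⟩ := A.bounded
    obtain ⟨M, hM⟩ := B.bounded
    refine ⟨N + M, fun n hn => ?_⟩
    refine (finsum_congr fun p => ?_).trans finsum_zero
    by_cases hp : N < p.1
    · rw [hN p.1 hp, zero_mul, smul_zero]
    · rw [hM (n - p.1 + p.2) (by omega), iterate_map_zero, mul_zero, smul_zero]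

/-- The formal adjoint `(∑ i, a i * D ^ i)* = ∑ i, (-D) ^ i * a i`. -/
def adjoint (A : PsiDO K) : PsiDO K where
  coeff n := ∑ᶠ l : ℕ,
    ((n + l).negOnePow : ℤ) • Ring.choose (n + (l : ℤ)) l •
      (pderiv K (1 : ℕ+))^[l] (A.coeff (n + l))
  bounded := by
    obtain ⟨N, hN⟩ := A.bounded
    refine ⟨N, fun n hn => (finsum_congr fun l => ?_).trans finsum_zero⟩
    rw [hN (n + l) (by omega), iterate_map_zero, smul_zero, smul_zero]

/-- The purely differential part `∑ i ≥ 0, a i * D ^ i`. -/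
def plus (A : PsiDO K) : PsiDO K where
  coeff i := if 0 ≤ i then A.coeff i else 0
  bounded := by
    obtain ⟨N, hN⟩ := A.bounded
    exact ⟨N, fun i hi => by simp [hN i hi]⟩

/-- The purely pseudo-differential part `∑ i < 0, a i * D ^ i`. -/
def minus (A : PsiDO K) : PsiDO K where
  coeff i := if i < 0 then A.coeff i else 0
  bounded := by
    obtain ⟨N, hN⟩ := A.bounded
    exact ⟨N, fun i hi => by simp [hN i hi]⟩

/-- The derivative of the coefficients with respect to the time `t n`. -/
def timeDeriv (n : ℕ+) (A : PsiDO K) : PsiDO K where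
  coeff i := pderiv K n (A.coeff i)
  bounded := by
    obtain ⟨N, hN⟩ := A.bounded
    exact ⟨N, fun i hi => by rw [hN i hi, map_zero]⟩

theorem isSpecBounded_symbol (ε : ℤˣ) (A : PsiDO K) :
    IsSpecBounded fun i : ℤ => (((ε ^ i : ℤˣ) : ℤ)) • A.coeff i := by
  intro m
  obtain ⟨N, hN⟩ := A.bounded
  exact ⟨N, fun i hi => by simp only [hN i hi, smul_zero, map_zero]⟩

/-- The action of `∑ i, a i * D ^ i` on the exponential `exp (ε * ξ(t, z))`, `ε = ± 1`, where
`D ^ i (exp (ε * ξ)) = (ε * z) ^ i * exp (ε * ξ)` for every integer `i`. -/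
def applyExp (ε : ℤˣ) (A : PsiDO K) : SpecFn K :=
  ofSpecCoeff (fun i : ℤ => (((ε ^ i : ℤˣ) : ℤ)) • A.coeff i) (isSpecBounded_symbol ε A) * expXi ε

end PsiDO

/-! ### The KP hierarchy and its Baker–Akhiezer functions -/

/-- `W = 1 + ∑ n ≥ 1, w n * D ^ (-n)`, and `V` is its inverse. -/
structure IsDressing (W V : PsiDO K) : Prop where
  coeff_zero : W.coeff 0 = 1
  coeff_pos : ∀ i : ℤ, 0 < i → W.coeff i = 0
  mul_inv : PsiDO.mul W V = PsiDO.D 0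
  inv_mul : PsiDO.mul V W = PsiDO.D 0

/-- The operator `L ^ (n / r) = W * D ^ n * W⁻¹` for the Lax operator `L = W * D ^ r * W⁻¹`, where
`V = W⁻¹`.  It does not depend on `r`, and it is `L` itself for `n = r`. -/
def laxPower (W V : PsiDO K) (n : ℕ+) : PsiDO K :=
  PsiDO.mul (PsiDO.mul W (PsiDO.D (n : ℤ))) V

/-- The Wilson–Sato equations `∂W/∂t n = - (L ^ (n / r))₋ W`. -/
def WilsonSato (W V : PsiDO K) : Prop :=
  ∀ (n : ℕ+) (i : ℤ), (W.timeDeriv n).coeff i =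
    - (PsiDO.mul (laxPower W V n).minus W).coeff i

/-- The Lax equations `∂L/∂t n = [(L ^ (n / r))₊, L]` of the KP hierarchy for
`L = W * D ^ r * W⁻¹`, where `V = W⁻¹`. -/
def LaxEquations (W V : PsiDO K) (r : ℕ+) : Prop :=
  ∀ (n : ℕ+) (i : ℤ), ((laxPower W V r).timeDeriv n).coeff i =
    (PsiDO.mul (laxPower W V n).plus (laxPower W V r)).coeff i -
      (PsiDO.mul (laxPower W V r) (laxPower W V n).plus).coeff i

/-- `ψ` and `ψs` are the Baker–Akhiezer and the adjoint Baker–Akhiezer function of a KP hierarchy: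
`ψ = W (exp ξ)` and `ψs = (W*)⁻¹ (exp (-ξ))` for a dressing operator `W` that solves the
Wilson–Sato equations, and the Lax operators `L = W * D ^ r * W⁻¹`, `r ≥ 1`, solve the Lax
equations.  The inverse of the adjoint is the adjoint of the inverse. -/
def IsBakerAkhiezerPair (ψ ψs : SpecFn K) : Prop :=
  ∃ W V : PsiDO K, IsDressing W V ∧ WilsonSato W V ∧ (∀ r : ℕ+, LaxEquations W V r) ∧
    ψ = W.applyExp 1 ∧ ψs = V.adjoint.applyExp (-1)

end KPHierarchy

end

noncomputable section

namespace KPHierarchy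

open MvPowerSeries

variable {K : Type*} [Field K]

/-! ### The ring of pseudo-differential operators -/

/-! Laurent series are written in the inverse parameter, so the residue is the coefficient of
exponent 1. Since `t` and `t'` are independent, Hirota's identity says that the `t`-coefficients of
ψ and those of ψ* are orthogonal for the residue pairing (`hirotaIdentity_iff`). It therefore
survives any operation on `t` alone.

From (a) to (b): the left side of the spectral identity does not involve `t'`. Differentiating in
`t'₁` gives `∫ dμ ψ(t, μ) ψ*(t', μ)` times ψ(t', λ), and the coefficient of λ⁰ in the latter factor
is an invertible power series (`ortho_of_spectralIdentity`).

From (b) to (a): let X and Y be the spans of the `t`-coefficients of ψ and ψ*. The spectral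
identities hold once each row of S is `-μ^(-i-1)` plus an element of Y and each column is `λ^(-j-1)`
plus an element of X, the monomials occurring only at `t = 0`. The antiderivative of ψψ* in `t₁` has
rows in Y and columns in X, so only a constant matrix S(0) is needed. It is built from reduced
elements `z^k + O(z⁻¹)` of X and Y, whose tails are tied together by orthogonality
(`exists_initial_potential`).

Dressing: write ψ = W(exp ξ) and ψ* = V*(exp(-ξ)). The residue of `P(exp ξ) A*(exp(-ξ))` is the
coefficient of `D⁻¹` in PA (`specIntegral_applyExp`). Hence if P(exp ξ) is orthogonal to ψ*, every
`D^k P V`, k ≥ 0, has zero residue, and PV has no negative part. For P = W this forces WV = 1. For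
`P = ∂ₙW + W Dⁿ - (W Dⁿ V)₊ W` the product PV also has order at most -1, so P = 0, which is the
Wilson–Sato equation; the Lax equations follow by differentiating `W D^r V`. -/

theorem iterate_derivation_mul {R A : Type*} [CommRing R] [CommRing A] [Algebra R A]
    (d : Derivation R A A) (n : ℕ) (a b : A) :
    d^[n] (a * b) =
      ∑ p ∈ Finset.HasAntidiagonal.antidiagonal n, n.choose p.1 • (d^[p.1] a * d^[p.2] b) := by
  induction n with
  | zero => simp
  | succ n ih =>
    rw [Finset.sum_antidiagonal_choose_succ_nsmul (fun i j => d^[i] a * d^[j] b) n,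
      Function.iterate_succ_apply', ih, map_sum, ← Finset.sum_add_distrib]
    refine Finset.sum_congr rfl fun p hp => ?_
    have h : n.choose p.2 = n.choose p.1 := by
      rw [← Finset.HasAntidiagonal.mem_antidiagonal.mp hp]
      exact (Nat.choose_symm_add).symm
    rw [map_nsmul, Derivation.leibniz, h, ← smul_add, smul_eq_mul, smul_eq_mul,
      Function.iterate_succ_apply', Function.iterate_succ_apply', mul_comm (d^[p.2] b)]

namespace PsiDO

local notation "∂₁" => MvPowerSeries.pderiv K (1 : ℕ+)

/-- All coefficients of order larger than `N` vanish. -/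
def OrderLE (A : PsiDO K) (N : ℤ) : Prop := ∀ i : ℤ, N < i → A.coeff i = 0

theorem OrderLE.mono {A : PsiDO K} {M N : ℤ} (h : A.OrderLE M) (hMN : M ≤ N) : A.OrderLE N :=
  fun i hi => h i (hMN.trans_lt hi)

instance : Zero (PsiDO K) := ⟨⟨fun _ => 0, 0, fun _ _ => rfl⟩⟩

instance : Neg (PsiDO K) := ⟨fun A => ⟨fun i => -A.coeff i, by
  obtain ⟨N, hN⟩ := A.bounded
  exact ⟨N, fun i hi => by rw [hN i hi, neg_zero]⟩⟩⟩

instance : Add (PsiDO K) := ⟨fun A B => ⟨fun i => A.coeff i + B.coeff i, by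
  obtain ⟨N, hN⟩ := A.bounded
  obtain ⟨M, hM⟩ := B.bounded
  exact ⟨max N M, fun i hi => by rw [hN i (by omega), hM i (by omega), add_zero]⟩⟩⟩

instance : One (PsiDO K) := ⟨D 0⟩

instance : Mul (PsiDO K) := ⟨mul⟩

@[simp] theorem zero_coeff (i : ℤ) : (0 : PsiDO K).coeff i = 0 := rfl

@[simp] theorem add_coeff (A B : PsiDO K) (i : ℤ) : (A + B).coeff i = A.coeff i + B.coeff i := rfl

@[simp] theorem neg_coeff (A : PsiDO K) (i : ℤ) : (-A).coeff i = -A.coeff i := rfl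

theorem D_coeff (n i : ℤ) : (D n : PsiDO K).coeff i = if i = n then 1 else 0 := rfl

theorem one_coeff (i : ℤ) : (1 : PsiDO K).coeff i = if i = 0 then 1 else 0 := rfl

theorem mul_coeff (A B : PsiDO K) (n : ℤ) : (A * B).coeff n = ∑ᶠ p : ℤ × ℕ,
    Ring.choose p.1 p.2 • (A.coeff p.1 * ∂₁^[p.2] (B.coeff (n - p.1 + p.2))) := rfl

theorem support_mul_term_subset {A B : PsiDO K} {N M : ℤ} (hA : A.OrderLE N) (hB : B.OrderLE M)
    {n a : ℤ} {L : ℕ} (ha : a ≤ n - M) (hL : N + M - n < L) :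
    (Function.support fun p : ℤ × ℕ =>
      Ring.choose p.1 p.2 • (A.coeff p.1 * ∂₁^[p.2] (B.coeff (n - p.1 + p.2)))) ⊆
      ((Finset.Icc a N ×ˢ Finset.range L : Finset (ℤ × ℕ)) : Set (ℤ × ℕ)) := by
  intro p hp
  have h1 : p.1 ≤ N := by
    by_contra! h
    exact hp (by simp only [hA _ h, zero_mul, smul_zero])
  have h2 : n - p.1 + p.2 ≤ M := by
    by_contra! h
    exact hp (by simp only [hB _ h, iterate_map_zero, mul_zero, smul_zero])
  simp only [Finset.coe_product, Set.mem_prod, Finset.mem_coe, Finset.mem_Icc, Finset.mem_range]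
  omega

theorem mul_coeff_eq_sum {A B : PsiDO K} {N M : ℤ} (hA : A.OrderLE N) (hB : B.OrderLE M)
    {n a : ℤ} {L : ℕ} (ha : a ≤ n - M) (hL : N + M - n < L) :
    (A * B).coeff n = ∑ p ∈ Finset.Icc a N ×ˢ Finset.range L,
      Ring.choose p.1 p.2 • (A.coeff p.1 * ∂₁^[p.2] (B.coeff (n - p.1 + p.2))) :=
  finsum_eq_finsetSum_of_support_subset _ (support_mul_term_subset hA hB ha hL)

theorem OrderLE.mul {A B : PsiDO K} {N M : ℤ} (hA : A.OrderLE N) (hB : B.OrderLE M) :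
    (A * B).OrderLE (N + M) := by
  intro n hn
  rw [mul_coeff_eq_sum hA hB (L := 0) le_rfl (by push_cast; omega)]
  simp

theorem OrderLE.add {A B : PsiDO K} {N : ℤ} (hA : A.OrderLE N) (hB : B.OrderLE N) :
    (A + B).OrderLE N := fun i hi => by simp [hA i hi, hB i hi]

theorem exists_orderLE (A : PsiDO K) : ∃ N, A.OrderLE N := A.bounded

/-- A single finite index set serves all the products in a distributive law, which can then be
compared term by term. -/
theorem exists_common_sum (A A' B B' : PsiDO K) (n : ℤ) : ∃ s : Finset (ℤ × ℕ),
    ∀ X Y : PsiDO K, (X = A ∨ X = A' ∨ X = A + A') → (Y = B ∨ Y = B' ∨ Y = B + B') →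
      (X * Y).coeff n =
        ∑ p ∈ s, Ring.choose p.1 p.2 • (X.coeff p.1 * ∂₁^[p.2] (Y.coeff (n - p.1 + p.2))) := by
  obtain ⟨N, hN⟩ := A.exists_orderLE
  obtain ⟨N', hN'⟩ := A'.exists_orderLE
  obtain ⟨M, hM⟩ := B.exists_orderLE
  obtain ⟨M', hM'⟩ := B'.exists_orderLE
  have hN := hN.mono (le_max_left N N')
  have hN' := hN'.mono (le_max_right N N')
  have hM := hM.mono (le_max_left M M')
  have hM' := hM'.mono (le_max_right M M')
  refine ⟨_, fun X Y hX hY => mul_coeff_eq_sum (N := max N N') (M := max M M') (a := n - max M M')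
    (L := (max N N' + max M M' - n + 1).toNat) ?_ ?_ le_rfl (by omega)⟩
  · rcases hX with rfl | rfl | rfl
    exacts [hN, hN', hN.add hN']
  · rcases hY with rfl | rfl | rfl
    exacts [hM, hM', hM.add hM']

theorem iterate_pderiv_add (l : ℕ) (f g : TimeFn K) :
    ∂₁^[l] (f + g) = ∂₁^[l] f + ∂₁^[l] g := iterate_map_add _ _ _ _

theorem right_distrib' (A A' B : PsiDO K) : (A + A') * B = A * B + A' * B := by
  ext1
  funext n
  obtain ⟨s, hs⟩ := exists_common_sum A A' B B n
  rw [add_coeff, hs _ _ (by simp) (Or.inl rfl), hs _ _ (by simp) (Or.inl rfl),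
    hs _ _ (by simp) (Or.inl rfl), ← Finset.sum_add_distrib]
  exact Finset.sum_congr rfl fun p _ => by rw [add_coeff, add_mul, smul_add]

theorem left_distrib' (A B B' : PsiDO K) : A * (B + B') = A * B + A * B' := by
  ext1
  funext n
  obtain ⟨s, hs⟩ := exists_common_sum A A B B' n
  rw [add_coeff, hs _ _ (Or.inl rfl) (by simp), hs _ _ (Or.inl rfl) (by simp),
    hs _ _ (Or.inl rfl) (by simp), ← Finset.sum_add_distrib]
  exact Finset.sum_congr rfl fun p _ => by
    rw [add_coeff, iterate_pderiv_add, mul_add, smul_add]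

theorem add_assoc' (A B C : PsiDO K) : A + B + C = A + (B + C) := by
  ext1; funext n; simp [add_assoc]

theorem neg_add_cancel' (A : PsiDO K) : -A + A = 0 := by
  ext1; funext n; simp

instance : AddCommGroup (PsiDO K) :=
  { AddGroup.ofLeftAxioms add_assoc' (fun A => by ext1; funext n; simp) neg_add_cancel' with
    add_comm := fun A B => by ext1; funext n; exact add_comm _ _ }

/-- The coefficient of `D ^ n`, as an additive map. -/
def coeffHom (n : ℤ) : PsiDO K →+ TimeFn K where
  toFun A := A.coeff n
  map_zero' := rfl
  map_add' _ _ := rfl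

/-- Left multiplication as an additive map. -/
def mulHom : PsiDO K →+ PsiDO K →+ PsiDO K :=
  AddMonoidHom.mk' (fun A => AddMonoidHom.mk' (fun B => A * B) (left_distrib' A))
    fun A A' => AddMonoidHom.ext fun B => right_distrib' A A' B

theorem mulHom_apply (A B : PsiDO K) : mulHom A B = A * B := rfl

@[simp] theorem sub_coeff (A B : PsiDO K) (n : ℤ) : (A - B).coeff n = A.coeff n - B.coeff n :=
  map_sub (coeffHom n) A B

theorem sum_coeff {ι : Type*} (s : Finset ι) (A : ι → PsiDO K) (n : ℤ) :
    (∑ i ∈ s, A i).coeff n = ∑ i ∈ s, (A i).coeff n :=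
  map_sum (coeffHom n) A s

/-- The operator `a * D ^ i`. -/
def monomial (a : TimeFn K) (i : ℤ) : PsiDO K where
  coeff n := if n = i then a else 0
  bounded := ⟨i, fun n hn => if_neg (by omega)⟩

theorem monomial_coeff (a : TimeFn K) (i n : ℤ) :
    (monomial a i).coeff n = if n = i then a else 0 := rfl

theorem monomial_orderLE (a : TimeFn K) (i : ℤ) : (monomial a i).OrderLE i :=
  fun _ hn => if_neg hn.ne'

theorem D_eq_monomial (n : ℤ) : (D n : PsiDO K) = monomial 1 n := rfl

theorem D_orderLE (n : ℤ) : (D n : PsiDO K).OrderLE n := monomial_orderLE 1 n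

/-- Measuring orders by their distance `s` below the top makes the sum finite: the drop `s` splits
into the drop in `A` and the number of derivatives of `c`. -/
theorem mul_monomial_coeff {A : PsiDO K} {N : ℤ} (hA : A.OrderLE N) (c : TimeFn K) (k : ℤ)
    (s : ℕ) : (A * monomial c k).coeff (N + k - s) = ∑ p ∈ Finset.HasAntidiagonal.antidiagonal s,
      Ring.choose (N - p.1) p.2 • (A.coeff (N - p.1) * ∂₁^[p.2] c) := by
  rw [mul_coeff, finsum_eq_finsetSum_of_support_subset (s := (Finset.HasAntidiagonal.antidiagonal s).image
    fun p : ℕ × ℕ => (N - (p.1 : ℤ), p.2)), Finset.sum_image]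
  · refine Finset.sum_congr rfl fun p hp => ?_
    have := Finset.HasAntidiagonal.mem_antidiagonal.mp hp
    rw [monomial_coeff, if_pos (by dsimp only; omega)]
  · rintro ⟨a, b⟩ _ ⟨a', b'⟩ _ h
    simp only [Prod.mk.injEq] at h ⊢
    omega
  · rintro ⟨i, l⟩ hp
    have h1 : i ≤ N := by
      by_contra! h
      exact hp (by simp only [hA _ h, zero_mul, smul_zero])
    have h2 : N + k - s - i + l = k := by
      by_contra h
      exact hp (by simp only [monomial_coeff, if_neg h, iterate_map_zero, mul_zero, smul_zero])
    simp only [Finset.coe_image, Set.mem_image, Finset.mem_coe, Finset.HasAntidiagonal.mem_antidiagonal,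
      Prod.mk.injEq]
    exact ⟨((N - i).toNat, l), by dsimp only; omega, by dsimp only; omega, rfl⟩

theorem monomial_mul_coeff {B : PsiDO K} {M : ℤ} (hB : B.OrderLE M) (a : TimeFn K) (i : ℤ)
    (s : ℕ) : (monomial a i * B).coeff (i + M - s) = ∑ p ∈ Finset.HasAntidiagonal.antidiagonal s,
      Ring.choose i p.1 • (a * ∂₁^[p.1] (B.coeff (M - p.2))) := by
  rw [mul_coeff, finsum_eq_finsetSum_of_support_subset (s := (Finset.HasAntidiagonal.antidiagonal s).image
    fun p : ℕ × ℕ => (i, p.1)), Finset.sum_image]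
  · refine Finset.sum_congr rfl fun p hp => ?_
    have := Finset.HasAntidiagonal.mem_antidiagonal.mp hp
    rw [monomial_coeff, if_pos rfl]
    congr 4
    dsimp only
    omega
  · rintro ⟨a, b⟩ h1 ⟨a', b'⟩ h2 h
    simp only [Prod.mk.injEq, Finset.mem_coe, Finset.HasAntidiagonal.mem_antidiagonal] at h h1 h2 ⊢
    omega
  · rintro ⟨j, l⟩ hp
    have h1 : j = i := by
      by_contra h
      exact hp (by simp only [monomial_coeff, if_neg h, zero_mul, smul_zero])
    subst h1
    have h2 : j + M - s - j + l ≤ M := by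
      by_contra! h
      exact hp (by simp only [hB _ h, iterate_map_zero, mul_zero, smul_zero])
    simp only [Finset.coe_image, Set.mem_image, Finset.mem_coe, Finset.HasAntidiagonal.mem_antidiagonal,
      Prod.mk.injEq]
    exact ⟨(l, s - l), by dsimp only; omega, by simp⟩

theorem monomial_mul_monomial_coeff (a b : TimeFn K) (i j : ℤ) (s : ℕ) :
    (monomial a i * monomial b j).coeff (i + j - s) = Ring.choose i s • (a * ∂₁^[s] b) := by
  rw [monomial_mul_coeff (monomial_orderLE b j), Finset.sum_eq_single (s, 0)]
  · simp [monomial_coeff]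
  · rintro ⟨p, q⟩ hp h
    have := Finset.HasAntidiagonal.mem_antidiagonal.mp hp
    rw [monomial_coeff, if_neg, iterate_map_zero, mul_zero, smul_zero]
    intro h'
    apply h
    simp only [Prod.mk.injEq] at this ⊢
    omega
  · intro h
    exact absurd (Finset.HasAntidiagonal.mem_antidiagonal.mpr (add_zero s)) h

/-! ### Associativity of the product. -/

theorem iterate_pderiv_zsmul (l : ℕ) (c : ℤ) (f : TimeFn K) :
    ∂₁^[l] (c • f) = c • ∂₁^[l] f :=
  Function.Commute.iterate_left (fun f => map_zsmul ∂₁ c f) l f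

/-- Trinomial revision extracts `Ring.choose i l`; what remains is the Chu–Vandermonde identity for
`(i - l) + j`. This is the whole content of associativity on monomials. -/
theorem choose_vandermonde (i j : ℤ) (l m : ℕ) :
    ∑ p ∈ Finset.HasAntidiagonal.antidiagonal m,
      Ring.choose i (l + p.1) * (Ring.choose j p.2 * ((l + p.1).choose l : ℤ)) =
    Ring.choose i l * Ring.choose (i + j - l) m := by
  rw [show i + j - l = (i - l) + j by ring, Ring.add_choose_eq m (Commute.all _ _),
    Finset.mul_sum]
  refine Finset.sum_congr rfl fun p _ => ?_
  have h := Ring.choose_smul_choose i (Nat.le_add_right l p.1)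
  rw [Nat.add_sub_cancel_left, nsmul_eq_mul] at h
  linear_combination (Ring.choose j p.2) * h

theorem monomial_assoc (a b c : TimeFn K) (i j k : ℤ) :
    monomial a i * monomial b j * monomial c k = monomial a i * (monomial b j * monomial c k) := by
  have hij := (monomial_orderLE a i).mul (monomial_orderLE b j)
  have hjk := (monomial_orderLE b j).mul (monomial_orderLE c k)
  ext1
  funext n
  rcases lt_or_ge (i + j + k) n with hn | hn
  · rw [hij.mul (monomial_orderLE c k) n hn,
      (monomial_orderLE a i).mul hjk n (by omega)]
  obtain ⟨s, rfl⟩ : ∃ s : ℕ, n = i + j + k - s := ⟨(i + j + k - n).toNat, by omega⟩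
  rw [mul_monomial_coeff hij, show i + j + k - (s : ℤ) = i + (j + k) - s by ring,
    monomial_mul_coeff hjk]
  trans ∑ x ∈ Finset.HasAntidiagonal.antidiagonal s,
      ∑ p ∈ Finset.HasAntidiagonal.antidiagonal x.2,
      (Ring.choose i (x.1 + p.1) * (Ring.choose j p.2 * ((x.1 + p.1).choose x.1 : ℤ))) •
        (a * (∂₁^[x.1] b * ∂₁^[p.1 + p.2] c))
  · refine Finset.sum_congr rfl fun x _ => ?_
    have h : ∀ p ∈ Finset.HasAntidiagonal.antidiagonal x.2,
        (Ring.choose i (x.1 + p.1) * (Ring.choose j p.2 * ((x.1 + p.1).choose x.1 : ℤ))) •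
        (a * (∂₁^[x.1] b * ∂₁^[p.1 + p.2] c)) =
        (Ring.choose i (x.1 + p.1) * (Ring.choose j p.2 * ((x.1 + p.1).choose x.1 : ℤ))) •
        (a * (∂₁^[x.1] b * ∂₁^[x.2] c)) := fun p hp => by
      rw [Finset.HasAntidiagonal.mem_antidiagonal.mp hp]
    rw [Finset.sum_congr rfl h, ← Finset.sum_smul, choose_vandermonde,
      monomial_mul_monomial_coeff, smul_mul_assoc, smul_smul, mul_assoc a, mul_comm]
  · simp only [monomial_mul_monomial_coeff, iterate_pderiv_zsmul, iterate_derivation_mul,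
      Finset.smul_sum, Finset.mul_sum, Finset.sum_sigma']
    refine Finset.sum_nbij' (fun x => ⟨(x.1.1 + x.2.1, x.2.2), (x.1.1, x.2.1)⟩)
      (fun x => ⟨(x.2.1, x.2.2 + x.1.2), (x.2.2, x.1.2)⟩) ?_ ?_ ?_ ?_ ?_
    · rintro ⟨⟨l, m⟩, r, p⟩ h
      simp only [Finset.mem_sigma, Finset.HasAntidiagonal.mem_antidiagonal] at h ⊢
      exact ⟨by omega, trivial⟩
    · rintro ⟨⟨q, p⟩, l, r⟩ h
      simp only [Finset.mem_sigma, Finset.HasAntidiagonal.mem_antidiagonal] at h ⊢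
      exact ⟨by omega, trivial⟩
    · rintro ⟨⟨l, m⟩, r, p⟩ h
      simp only [Finset.mem_sigma, Finset.HasAntidiagonal.mem_antidiagonal] at h
      obtain ⟨_, rfl⟩ := h
      rfl
    · rintro ⟨⟨q, p⟩, l, r⟩ h
      simp only [Finset.mem_sigma, Finset.HasAntidiagonal.mem_antidiagonal] at h
      obtain ⟨_, rfl⟩ := h
      rfl
    · rintro ⟨⟨l, m⟩, r, p⟩ _
      simp only [← Function.iterate_add_apply, mul_smul_comm, ← Nat.cast_smul_eq_nsmul ℤ,
        smul_smul]

/-- The terms of order at least `m`. -/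
def cut (A : PsiDO K) (m : ℤ) : PsiDO K where
  coeff i := if m ≤ i then A.coeff i else 0
  bounded := by
    obtain ⟨N, hN⟩ := A.bounded
    exact ⟨N, fun i hi => by simp [hN i hi]⟩

theorem cut_coeff (A : PsiDO K) (m i : ℤ) :
    (A.cut m).coeff i = if m ≤ i then A.coeff i else 0 := rfl

theorem sub_cut_orderLE (A : PsiDO K) (m : ℤ) : (A - A.cut m).OrderLE (m - 1) := fun i hi => by
  rw [sub_coeff, cut_coeff, if_pos (by omega), sub_self]

theorem cut_eq_sum {A : PsiDO K} {N : ℤ} (hA : A.OrderLE N) (m : ℤ) :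
    A.cut m = ∑ i ∈ Finset.Icc m N, monomial (A.coeff i) i := by
  ext1
  funext n
  simp only [sum_coeff, monomial_coeff, cut_coeff, Finset.sum_ite_eq, Finset.mem_Icc]
  by_cases h : n ≤ N
  · simp [h]
  · simp [h, hA n (by omega)]

/-- The associator, as a triadditive map. -/
def associatorHom : PsiDO K →+ PsiDO K →+ PsiDO K →+ PsiDO K :=
  AddMonoidHom.mk' (fun A => AddMonoidHom.mk' (fun B => mulHom (A * B) - (mulHom A).comp (mulHom B))
    fun B B' => by
      ext1 C
      simp only [mulHom_apply, AddMonoidHom.sub_apply, AddMonoidHom.add_apply,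
        AddMonoidHom.comp_apply, left_distrib', right_distrib']
      abel)
    fun A A' => by
      ext1 B
      ext1 C
      simp only [mulHom_apply, AddMonoidHom.sub_apply, AddMonoidHom.add_apply,
        AddMonoidHom.comp_apply, right_distrib', AddMonoidHom.mk'_apply]
      abel

theorem associatorHom_apply (A B C : PsiDO K) :
    associatorHom A B C = A * B * C - A * (B * C) := rfl

theorem associator_orderLE {A B C : PsiDO K} {N M P : ℤ} (hA : A.OrderLE N) (hB : B.OrderLE M)
    (hC : C.OrderLE P) : (associatorHom A B C).OrderLE (N + M + P) := fun n hn => by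
  rw [associatorHom_apply, sub_coeff, (hA.mul hB).mul hC n hn, hA.mul (hB.mul hC) n (by omega),
    sub_zero]

theorem mul_assoc' (A B C : PsiDO K) : A * B * C = A * (B * C) := by
  obtain ⟨N, hN⟩ := A.exists_orderLE
  obtain ⟨M, hM⟩ := B.exists_orderLE
  obtain ⟨P, hP⟩ := C.exists_orderLE
  rw [← sub_eq_zero, ← associatorHom_apply]
  ext1
  funext n
  -- Each cut is placed so that the discarded tail affects the associator only in orders below `n`.
  -- What remains are finite sums of monomials.
  have hA := A.sub_cut_orderLE (n - M - P)
  obtain ⟨N', hN'⟩ := (A.cut (n - M - P)).exists_orderLE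
  have hB := B.sub_cut_orderLE (n - N' - P)
  obtain ⟨M', hM'⟩ := (B.cut (n - N' - P)).exists_orderLE
  have hC := C.sub_cut_orderLE (n - N' - M')
  have h1 := associator_orderLE hA hM hP n (by omega)
  have h2 := associator_orderLE hN' hB hP n (by omega)
  have h3 := associator_orderLE hN' hM' hC n (by omega)
  simp only [map_sub, AddMonoidHom.sub_apply, sub_coeff, sub_eq_zero] at h1 h2 h3
  rw [h1, h2, h3, cut_eq_sum hN, cut_eq_sum hM, cut_eq_sum hP]
  simp only [map_sum, AddMonoidHom.finsetSum_apply, associatorHom_apply, monomial_assoc, sub_self,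
    Finset.sum_const_zero]

theorem mul_D_coeff (A : PsiDO K) (k n : ℤ) : (A * D k).coeff n = A.coeff (n - k) := by
  rw [mul_coeff, finsum_eq_single _ (n - k, 0)]
  · simp [D_coeff]
  · rintro ⟨i, l⟩ h
    rw [D_coeff]
    split_ifs with h'
    · obtain rfl | hl := Nat.eq_zero_or_pos l
      · exact absurd (by simp only [Prod.mk.injEq, and_true]; simp at h'; omega) h
      · obtain ⟨l, rfl⟩ := Nat.exists_eq_succ_of_ne_zero hl.ne'
        rw [Function.iterate_succ_apply, pderiv_one, iterate_map_zero, mul_zero, smul_zero]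
    · rw [iterate_map_zero, mul_zero, smul_zero]

theorem monomial_zero_mul_coeff (a : TimeFn K) (B : PsiDO K) (n : ℤ) :
    (monomial a 0 * B).coeff n = a * B.coeff n := by
  rw [mul_coeff, finsum_eq_single _ (0, 0)]
  · simp [monomial_coeff]
  · rintro ⟨i, l⟩ h
    rw [monomial_coeff]
    split_ifs with h'
    · dsimp only at h'
      subst h'
      obtain rfl | hl := Nat.eq_zero_or_pos l
      · exact absurd rfl h
      · rw [Ring.choose_zero_pos ℤ hl, zero_smul]
    · rw [zero_mul, smul_zero]

theorem mul_one' (A : PsiDO K) : A * 1 = A := by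
  ext1; funext n; exact (mul_D_coeff A 0 n).trans (by rw [sub_zero])

theorem one_mul' (A : PsiDO K) : 1 * A = A := by
  ext1; funext n; exact (monomial_zero_mul_coeff 1 A n).trans (one_mul _)

instance : Ring (PsiDO K) :=
  { (inferInstance : AddCommGroup (PsiDO K)) with
    mul_assoc := mul_assoc'
    one_mul := one_mul'
    mul_one := mul_one'
    left_distrib := left_distrib'
    right_distrib := right_distrib'
    zero_mul := fun A => DFunLike.congr_fun (map_zero mulHom) A
    mul_zero := fun A => map_zero (mulHom A) }

theorem one_eq_D : (1 : PsiDO K) = D 0 := rfl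

theorem D_mul_D (m n : ℤ) : (D m * D n : PsiDO K) = D (m + n) := by
  ext1
  funext i
  rw [mul_D_coeff, D_coeff, D_coeff]
  congr 1
  exact propext (by omega)

theorem monomial_zero_mul_D (a : TimeFn K) (i : ℤ) : monomial a 0 * D i = monomial a i := by
  ext1
  funext n
  rw [monomial_zero_mul_coeff, D_coeff, monomial_coeff, mul_ite, mul_one, mul_zero]

theorem D_one_mul (A : PsiDO K) : D 1 * A = A.timeDeriv 1 + A * D 1 := by
  ext1
  funext n
  rw [add_coeff, mul_D_coeff, mul_coeff,
    finsum_eq_finsetSum_of_support_subset (s := {((1 : ℤ), 1), ((1 : ℤ), 0)}),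
    Finset.sum_pair (by simp)]
  · simp [D_coeff, timeDeriv]
  · rintro ⟨i, l⟩ h
    have h1 : i = 1 := by
      by_contra h'
      exact h (by simp only [D_coeff, if_neg h', zero_mul, smul_zero])
    subst h1
    have h2 : l ≤ 1 := by
      by_contra! h'
      apply h
      have := Ring.choose_natCast (R := ℤ) 1 l
      rw [Nat.choose_eq_zero_of_lt h'] at this
      simp only [Nat.cast_one, Nat.cast_zero] at this
      simp only [this, zero_smul]
    interval_cases l <;> simp

/-! ### Time derivatives as derivations of the operator ring. -/

theorem pderiv_comm (i j : ℕ+) (f : TimeFn K) :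
    pderiv K i (pderiv K j f) = pderiv K j (pderiv K i f) := by
  classical
  ext m
  simp only [coeff_pderiv, Finsupp.add_apply]
  rw [add_right_comm]
  by_cases h : i = j
  · subst h; rfl
  · simp only [Finsupp.single_apply, if_neg h, if_neg (Ne.symm h)]
    ring_nf

theorem timeDeriv_coeff (n : ℕ+) (A : PsiDO K) (i : ℤ) :
    (A.timeDeriv n).coeff i = pderiv K n (A.coeff i) := rfl

theorem OrderLE.timeDeriv {A : PsiDO K} {N : ℤ} (hA : A.OrderLE N) (n : ℕ+) :
    (A.timeDeriv n).OrderLE N := fun i hi => by rw [timeDeriv_coeff, hA i hi, map_zero]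

theorem timeDeriv_mul (n : ℕ+) (A B : PsiDO K) :
    (A * B).timeDeriv n = A.timeDeriv n * B + A * B.timeDeriv n := by
  obtain ⟨N, hN⟩ := A.exists_orderLE
  obtain ⟨M, hM⟩ := B.exists_orderLE
  ext1
  funext i
  have hL : N + M - i < ((N + M - i + 1).toNat : ℤ) := by omega
  rw [add_coeff, timeDeriv_coeff, mul_coeff_eq_sum hN hM le_rfl hL,
    mul_coeff_eq_sum (hN.timeDeriv n) hM le_rfl hL, mul_coeff_eq_sum hN (hM.timeDeriv n) le_rfl hL,
    map_sum, ← Finset.sum_add_distrib]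
  refine Finset.sum_congr rfl fun p _ => ?_
  rw [map_zsmul, Derivation.leibniz, timeDeriv_coeff, timeDeriv_coeff, ← smul_add, smul_eq_mul,
    smul_eq_mul, add_comm, mul_comm (pderiv K n (A.coeff p.1)),
    (Function.Commute.iterate_left (fun f => pderiv_comm 1 n f) p.2).eq, mul_comm (∂₁^[p.2] _)]

theorem timeDeriv_D (n : ℕ+) (k : ℤ) : (D k : PsiDO K).timeDeriv n = 0 := by
  ext1
  funext i
  rw [timeDeriv_coeff, D_coeff]
  split_ifs
  · exact pderiv_one
  · exact map_zero _

/-! ### Formal adjoint and residue -/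

theorem adjoint_coeff {A : PsiDO K} {N : ℤ} (hA : A.OrderLE N) (s : ℕ) :
    A.adjoint.coeff (N - s) = ∑ p ∈ Finset.HasAntidiagonal.antidiagonal s,
      ((N - p.2).negOnePow : ℤ) • Ring.choose (N - p.2) p.1 • ∂₁^[p.1] (A.coeff (N - p.2)) := by
  change (∑ᶠ l : ℕ, ((N - s + l).negOnePow : ℤ) • Ring.choose (N - s + (l : ℤ)) l •
      ∂₁^[l] (A.coeff (N - s + l))) = _
  rw [finsum_eq_finsetSum_of_support_subset
    (s := (Finset.HasAntidiagonal.antidiagonal s).image Prod.fst), Finset.sum_image]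
  · refine Finset.sum_congr rfl fun p hp => ?_
    have := Finset.HasAntidiagonal.mem_antidiagonal.mp hp
    rw [show N - s + (p.1 : ℤ) = N - p.2 by omega]
  · rintro ⟨a, b⟩ h1 ⟨a', b'⟩ h2 h
    simp only [Prod.mk.injEq, Finset.mem_coe, Finset.HasAntidiagonal.mem_antidiagonal] at h h1 h2 ⊢
    omega
  · intro l hl
    have h : N - s + l ≤ N := by
      by_contra! h
      exact hl (by simp only [hA _ h, iterate_map_zero, smul_zero])
    simp only [Finset.coe_image, Set.mem_image, Finset.mem_coe,
      Finset.HasAntidiagonal.mem_antidiagonal]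
    exact ⟨(l, s - l), by dsimp only; omega, rfl⟩

theorem OrderLE.adjoint {A : PsiDO K} {N : ℤ} (hA : A.OrderLE N) : A.adjoint.OrderLE N :=
  fun n hn => (finsum_congr fun l => by
    rw [hA (n + l) (by omega), iterate_map_zero, smul_zero, smul_zero]).trans finsum_zero

theorem negOnePow_mul_add (n : ℤ) (m : ℕ) :
    ((n + m).negOnePow : ℤ) * (n.negOnePow : ℤ) = (-1) ^ m := by
  rw [Int.negOnePow_add, Units.val_mul, mul_right_comm, ← Units.val_mul, ← Int.negOnePow_add,
    Int.negOnePow_even _ (Even.add_self n), Int.negOnePow_def]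
  simp

theorem sum_antidiagonal_neg_one_pow_choose (k : ℕ) :
    ∑ p ∈ Finset.HasAntidiagonal.antidiagonal k, (-1 : ℤ) ^ p.1 * (k.choose p.1 : ℤ) =
      if k = 0 then 1 else 0 := by
  rw [Finset.Nat.sum_antidiagonal_eq_sum_range_succ_mk]
  exact Int.alternating_sum_range_choose

theorem iterate_pderiv_sum {ι : Type*} (s : Finset ι) (f : ι → TimeFn K) (l : ℕ) :
    ∂₁^[l] (∑ i ∈ s, f i) = ∑ i ∈ s, ∂₁^[l] (f i) := by
  induction l generalizing f with
  | zero => rfl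
  | succ l ih => simp only [Function.iterate_succ_apply, map_sum, ih]

/-- Collecting the terms with `k` derivatives in all, the coefficient contains the alternating sum
of the binomials `k.choose m`, which vanishes unless `k = 0`. -/
theorem adjoint_adjoint (A : PsiDO K) : A.adjoint.adjoint = A := by
  obtain ⟨N, hN⟩ := A.exists_orderLE
  ext1
  funext n
  rcases lt_or_ge N n with hn | hn
  · rw [hN.adjoint.adjoint n hn, hN n hn]
  obtain ⟨s, rfl⟩ : ∃ s : ℕ, n = N - s := ⟨(N - n).toNat, by omega⟩
  rw [adjoint_coeff hN.adjoint]
  trans ∑ x ∈ Finset.HasAntidiagonal.antidiagonal s,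
      ∑ p ∈ Finset.HasAntidiagonal.antidiagonal x.1,
        ((-1 : ℤ) ^ p.1 * (x.1.choose p.1 : ℤ)) •
          Ring.choose (N - x.2) x.1 • ∂₁^[x.1] (A.coeff (N - x.2))
  · simp only [adjoint_coeff hN, iterate_pderiv_zsmul, iterate_pderiv_sum, Finset.smul_sum,
      Finset.sum_sigma', ← Function.iterate_add_apply]
    refine Finset.sum_nbij' (fun x => ⟨(x.1.1 + x.2.1, x.2.2), (x.2.1, x.1.1)⟩)
      (fun x => ⟨(x.2.2, x.2.1 + x.1.2), (x.2.1, x.1.2)⟩) ?_ ?_ ?_ ?_ ?_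
    · rintro ⟨⟨l, m⟩, r, p⟩ h
      simp only [Finset.mem_sigma, Finset.HasAntidiagonal.mem_antidiagonal] at h ⊢
      constructor <;> omega
    · rintro ⟨⟨q, p⟩, l, r⟩ h
      simp only [Finset.mem_sigma, Finset.HasAntidiagonal.mem_antidiagonal] at h ⊢
      exact ⟨by omega, trivial⟩
    · rintro ⟨⟨l, m⟩, r, p⟩ h
      simp only [Finset.mem_sigma, Finset.HasAntidiagonal.mem_antidiagonal] at h
      obtain ⟨_, rfl⟩ := h
      rfl
    · rintro ⟨⟨q, p⟩, l, r⟩ h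
      simp only [Finset.mem_sigma, Finset.HasAntidiagonal.mem_antidiagonal] at h
      obtain ⟨_, rfl⟩ := h
      simp [add_comm]
    · rintro ⟨⟨l, u⟩, m, v⟩ h
      simp only [Finset.mem_sigma, Finset.HasAntidiagonal.mem_antidiagonal] at h
      obtain ⟨_, rfl⟩ := h
      dsimp only
      rw [smul_smul, smul_smul, smul_smul, smul_smul]
      congr 1
      have h1 := negOnePow_mul_add (N - (m + v : ℕ)) m
      rw [show N - ((m + v : ℕ) : ℤ) + m = N - v by push_cast; ring] at h1
      have h2 := Ring.choose_smul_choose (N - (v : ℤ)) (Nat.le_add_left m l)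
      rw [Nat.add_sub_cancel, nsmul_eq_mul, show N - (v : ℤ) - m = N - (m + v : ℕ) by
        push_cast; ring] at h2
      rw [← h1, mul_assoc _ _ (Ring.choose _ (l + m)), h2]
      ring
  · simp only [← Finset.sum_smul, sum_antidiagonal_neg_one_pow_choose]
    rw [Finset.sum_eq_single (0, s)]
    · simp
    · rintro ⟨k, v⟩ hp h
      have := Finset.HasAntidiagonal.mem_antidiagonal.mp hp
      rw [if_neg, zero_smul]
      intro h'
      apply h
      simp only [Prod.mk.injEq] at this h' ⊢
      omega
    · intro h
      exact absurd (Finset.HasAntidiagonal.mem_antidiagonal.mpr (zero_add s)) h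

/-- The two sums agree term by term after upper negation, `choose i p = (-1)^p choose (p - i - 1)
p`. -/
theorem residue_D_mul (i : ℤ) (A : PsiDO K) : (D i * A).coeff (-1) =
    ((-1 - i).negOnePow : ℤ) • A.adjoint.coeff (-1 - i) := by
  obtain ⟨M, hM⟩ := A.exists_orderLE
  rcases lt_or_ge (i + M) (-1) with h | h
  · rw [(D_orderLE i).mul hM _ h, hM.adjoint _ (by omega), smul_zero]
  obtain ⟨s, hs⟩ : ∃ s : ℕ, -1 = i + M - s := ⟨(i + M + 1).toNat, by omega⟩
  rw [show (-1 : ℤ) - i = M - s by omega, hs, D_eq_monomial, monomial_mul_coeff hM,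
    adjoint_coeff hM, Finset.smul_sum]
  refine Finset.sum_congr rfl fun p hp => ?_
  have hp := Finset.HasAntidiagonal.mem_antidiagonal.mp hp
  have h1 := negOnePow_mul_add (M - s) p.1
  have h2 := Ring.choose_neg (-i) p.1
  rw [neg_neg, show -i + (p.1 : ℤ) - 1 = M - p.2 by omega, Units.smul_def, smul_eq_mul,
    Int.negOnePow_def, zpow_natCast] at h2
  rw [show M - (s : ℤ) + p.1 = M - p.2 by omega, mul_comm] at h1
  rw [one_mul, smul_smul, smul_smul, mul_assoc, ← mul_assoc _ (Int.negOnePow _ : ℤ), h1, h2]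
  simp

theorem residue_mul {P A : PsiDO K} {N M : ℤ} (hP : P.OrderLE N) (hA : A.OrderLE M) :
    (P * A).coeff (-1) = ∑ i ∈ Finset.Icc (-1 - M) N,
      P.coeff i * (((-1 - i).negOnePow : ℤ) • A.adjoint.coeff (-1 - i)) := by
  -- Terms of `P` of order below `-1 - M` contribute only to orders below `-1`.
  have h := (P.sub_cut_orderLE (-1 - M)).mul hA (-1) (by omega)
  rw [sub_mul, sub_coeff, sub_eq_zero] at h
  rw [h, cut_eq_sum hP, Finset.sum_mul, sum_coeff]
  refine Finset.sum_congr rfl fun i _ => ?_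
  rw [← monomial_zero_mul_D, mul_assoc, monomial_zero_mul_coeff, residue_D_mul]

theorem mul_coeff_add {A B : PsiDO K} {N M : ℤ} (hA : A.OrderLE N) (hB : B.OrderLE M) :
    (A * B).coeff (N + M) = A.coeff N * B.coeff M := by
  rw [mul_coeff_eq_sum hA hB (a := N) (L := 1) (by omega) (by push_cast; omega)]
  simp

/-- Leading coefficients multiply, so the order bound on `B` can be lowered indefinitely. -/
theorem eq_zero_of_monic_mul_eq_zero {A B : PsiDO K} {N : ℤ} (hA : A.OrderLE N)
    (hA1 : A.coeff N = 1) (h : A * B = 0) : B = 0 := by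
  obtain ⟨M, hM⟩ := B.exists_orderLE
  have key : ∀ j : ℕ, B.OrderLE (M - j) := by
    intro j
    induction j with
    | zero => simpa using hM
    | succ j ih =>
      intro i hi
      rcases eq_or_lt_of_le (show M - j ≤ i by push_cast at hi; omega) with rfl | h'
      · have := mul_coeff_add hA ih
        rwa [h, hA1, one_mul, zero_coeff, eq_comm] at this
      · exact ih i h'
  ext1
  funext i
  exact key (M - i + 1).toNat i (by omega)

/-- An operator all of whose residues after left multiplication by the nonnegative powers of `D`
vanish is differential. -/
theorem coeff_eq_zero_of_residue {A : PsiDO K}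
    (h : ∀ k : ℕ, (D k * A).coeff (-1) = 0) (i : ℤ) (hi : i < 0) : A.coeff i = 0 := by
  -- The residue of `D k * A` is, up to sign, the coefficient of order `-1 - k` of the adjoint;
  -- hence the adjoint is differential.
  have h' : ∀ n < 0, A.adjoint.coeff n = 0 := fun n hn => by
    have := h (-1 - n).toNat
    rw [residue_D_mul, show (-1 : ℤ) - ((-1 - n).toNat : ℤ) = n by omega] at this
    rcases Int.units_eq_one_or n.negOnePow with h1 | h1 <;> simpa [h1] using this
  rw [← A.adjoint_adjoint]
  refine (finsum_congr fun l => ?_).trans finsum_zero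
  rcases lt_or_ge (i + l) 0 with hl | hl
  · rw [h' _ hl, iterate_map_zero, smul_zero, smul_zero]
  -- Here `0 ≤ i + l < l`, so the binomial vanishes: the adjoint of a differential operator is
  -- differential.
  · have := Ring.choose_natCast (R := ℤ) (i + l).toNat l
    rw [Int.toNat_of_nonneg hl, Nat.choose_eq_zero_of_lt (by omega), Nat.cast_zero] at this
    rw [this, zero_smul, smul_zero]

end PsiDO

/-! ### Laurent series in the spectral parameter -/

theorem laurent_coeff_mul {f g : LaurentSeries K} {a b : ℤ} (hf : ∀ i < a, f.coeff i = 0)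
    (hg : ∀ i < b, g.coeff i = 0) (n : ℤ) :
    (f * g).coeff n = ∑ i ∈ Finset.Icc a (n - b), f.coeff i * g.coeff (n - i) := by
  rw [HahnSeries.coeff_mul]
  refine Finset.sum_of_injOn Prod.fst ?_ ?_ ?_ ?_
  · rintro ⟨i, j⟩ h ⟨i', j'⟩ h' hij
    simp only [Finset.mem_coe, Finset.mem_antidiagonal, Prod.mk.injEq] at h h' hij ⊢
    omega
  · rintro ⟨i, j⟩ h
    simp only [Finset.mem_coe, Finset.mem_antidiagonal, HahnSeries.mem_support] at h
    have h1 : a ≤ i := by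
      by_contra! hi
      exact h.1 (hf i hi)
    have h2 : b ≤ j := by
      by_contra! hj
      exact h.2.1 (hg j hj)
    simp only [Finset.coe_Icc, Set.mem_Icc]
    omega
  · intro i _ hi
    by_contra h
    refine hi ⟨(i, n - i), ?_, rfl⟩
    simp only [Finset.mem_coe, Finset.mem_antidiagonal, HahnSeries.mem_support]
    exact ⟨left_ne_zero_of_mul h, right_ne_zero_of_mul h, by ring⟩
  · rintro ⟨i, j⟩ h
    simp only [Finset.mem_antidiagonal] at h
    rw [show n - i = j by omega]

@[simp] theorem coeff_ofSpecCoeff (c : ℤ → TimeFn K) (hc : IsSpecBounded c) (m : ℕ+ →₀ ℕ) (k : ℤ) :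
    (coeff m (ofSpecCoeff c hc)).coeff k = coeff m (c (-k)) := rfl

theorem coeff_specCoeff {σ : Type*} (i : ℤ) (f : MvPowerSeries σ (LaurentSeries K)) (m : σ →₀ ℕ) :
    coeff m (specCoeff i f) = (coeff m f).coeff (-i) := rfl

theorem coeff_specIntegral {σ : Type*} (f : MvPowerSeries σ (LaurentSeries K)) (m : σ →₀ ℕ) :
    coeff m (specIntegral f) = (coeff m f).coeff 1 := rfl

theorem laurent_coeff_sum {ι : Type*} (s : Finset ι) (f : ι → LaurentSeries K) (k : ℤ) :
    (∑ i ∈ s, f i).coeff k = ∑ i ∈ s, (f i).coeff k :=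
  map_sum (HahnSeries.coeff.addMonoidHom k) f s

theorem specIntegral_ofSpecCoeff_mul {c d : ℤ → TimeFn K} (hc : IsSpecBounded c)
    (hd : IsSpecBounded d) {N M : ℤ} (hN : ∀ i, N < i → c i = 0) (hM : ∀ i, M < i → d i = 0) :
    specIntegral (ofSpecCoeff c hc * ofSpecCoeff d hd) =
      ∑ i ∈ Finset.Icc (-1 - M) N, c i * d (-1 - i) := by
  classical
  ext m
  rw [coeff_specIntegral, coeff_mul, laurent_coeff_sum, map_sum]
  simp only [coeff_mul]
  rw [Finset.sum_comm]
  refine Finset.sum_congr rfl fun p _ => ?_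
  rw [laurent_coeff_mul (a := -N) (b := -M)
    (fun i hi => by rw [coeff_ofSpecCoeff, hN _ (by omega), map_zero])
    (fun i hi => by rw [coeff_ofSpecCoeff, hM _ (by omega), map_zero])]
  refine Finset.sum_nbij' (fun i => -i) (fun i => -i) ?_ ?_ ?_ ?_ ?_
  · intro i; simp only [Finset.mem_Icc]; omega
  · intro i; simp only [Finset.mem_Icc]; omega
  · intro i _; exact neg_neg i
  · intro i _; exact neg_neg i
  · intro i _
    rw [coeff_ofSpecCoeff, coeff_ofSpecCoeff, show -(1 - i) = -1 - -i by ring]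

/-! ### The exponential -/

theorem coeff_expXi (ε : ℤˣ) (m : ℕ+ →₀ ℕ) : coeff m (expXi ε : SpecFn K) = m.prod fun n j =>
    HahnSeries.C ((Nat.factorial j : K)⁻¹) * ((((ε : ℤ) : LaurentSeries K)) * specVar ^ (n : ℕ)) ^ j :=
  rfl

theorem pderiv_expXi [CharZero K] (ε : ℤˣ) (n : ℕ+) :
    pderiv (LaurentSeries K) n (expXi ε) =
      C (((ε : ℤ) : LaurentSeries K) * specVar ^ (n : ℕ)) * expXi ε := by
  classical
  ext1 m
  rw [coeff_pderiv, coeff_C_mul, coeff_expXi, coeff_expXi]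
  set g : ℕ+ → ℕ → LaurentSeries K := fun n j =>
    HahnSeries.C ((Nat.factorial j : K)⁻¹) * ((((ε : ℤ) : LaurentSeries K)) * specVar ^ (n : ℕ)) ^ j
    with hg
  have g0 : ∀ i, g i 0 = 1 := fun i => by simp [hg]
  have h1 := Finsupp.mul_prod_erase' (m + Finsupp.single n 1) n g (fun i => g0 i)
  have h2 := Finsupp.mul_prod_erase' m n g (fun i => g0 i)
  have h3 : (m + Finsupp.single n 1).erase n = m.erase n := by
    rw [Finsupp.erase_add, Finsupp.erase_single, add_zero]
  rw [← h1, ← h2, h3, Finsupp.add_apply, Finsupp.single_eq_same]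
  -- Only the factor belonging to `t n` changes, and for it `(j + 1) / (j + 1)! = 1 / j!`.
  have h4 : g n (m n + 1) * ((m n : LaurentSeries K) + 1) =
      ((ε : ℤ) : LaurentSeries K) * specVar ^ (n : ℕ) * g n (m n) := by
    simp only [hg]
    have h5 : (HahnSeries.C ((Nat.factorial (m n + 1) : K)⁻¹) : LaurentSeries K) *
        ((m n : LaurentSeries K) + 1) = HahnSeries.C ((Nat.factorial (m n) : K)⁻¹) := by
      rw [← Nat.cast_add_one, ← map_natCast (HahnSeries.C : K →+* LaurentSeries K),
        ← map_mul, Nat.factorial_succ]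
      congr 1
      have := Nat.cast_add_one_ne_zero (R := K) (m n)
      push_cast
      field_simp
    rw [← h5, pow_succ]
    ring
  linear_combination (m.erase n).prod g * h4

theorem constantCoeff_expXi (ε : ℤˣ) : constantCoeff (expXi ε : SpecFn K) = 1 := by
  rw [← coeff_zero_eq_constantCoeff_apply, coeff_expXi, Finsupp.prod_zero_index]

theorem eq_C_of_pderiv_eq_zero {σ R : Type*} [CommRing R] [CharZero R] [NoZeroDivisors R]
    {f : MvPowerSeries σ R} (h : ∀ i, pderiv R i f = 0) : f = C (constantCoeff f) := by
  classical
  ext m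
  rw [coeff_C]
  split_ifs with hm
  · rw [hm, coeff_zero_eq_constantCoeff_apply]
  · obtain ⟨i, hi⟩ := Finsupp.ne_iff.mp hm
    have h1 := congrArg (coeff (m - Finsupp.single i 1)) (h i)
    rw [coeff_pderiv, map_zero] at h1
    have h2 : m - Finsupp.single i 1 + Finsupp.single i 1 = m :=
      tsub_add_cancel_of_le (Finsupp.single_le_iff.mpr (Nat.one_le_iff_ne_zero.mpr hi))
    rw [h2] at h1
    exact (mul_eq_zero.mp h1).resolve_right (Nat.cast_add_one_ne_zero _)

/-- All partial derivatives of the product cancel, so in characteristic zero it equals its constant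
term. -/
theorem expXi_mul_expXi_neg [CharZero K] : expXi 1 * expXi (-1) = (1 : SpecFn K) := by
  have : CharZero (LaurentSeries K) :=
    charZero_of_injective_ringHom (HahnSeries.C_injective (Γ := ℤ) (R := K))
  rw [eq_C_of_pderiv_eq_zero (f := expXi 1 * expXi (-1)), map_mul, constantCoeff_expXi,
    constantCoeff_expXi, mul_one, map_one]
  intro n
  rw [Derivation.leibniz, pderiv_expXi, pderiv_expXi]
  simp only [smul_eq_mul, Units.val_one, Units.val_neg, Int.cast_neg, Int.cast_one, one_mul,
    neg_mul, map_neg]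
  ring

/-! ### The action of pseudo-differential operators on the exponential -/

/-- A function of the multi-time, as a function that does not involve the spectral parameter. -/
def embed : TimeFn K →+* SpecFn K := MvPowerSeries.map HahnSeries.C

theorem coeff_embed_mul [DecidableEq ℕ+] (a : TimeFn K) (f : SpecFn K) (m : ℕ+ →₀ ℕ) :
    coeff m (embed a * f) = ∑ p ∈ Finset.HasAntidiagonal.antidiagonal m,
      coeff p.1 a • coeff p.2 f := by
  rw [coeff_mul]
  refine Finset.sum_congr rfl fun p _ => ?_
  rw [embed, coeff_map, HahnSeries.C_mul_eq_smul]

namespace PsiDO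

/-- The symbol `∑ i, a i * (ε * z) ^ i` of the operator `∑ i, a i * D ^ i`. -/
def symbol (ε : ℤˣ) (A : PsiDO K) : SpecFn K :=
  ofSpecCoeff (fun i : ℤ => (((ε ^ i : ℤˣ) : ℤ)) • A.coeff i) (isSpecBounded_symbol ε A)

theorem applyExp_eq (ε : ℤˣ) (A : PsiDO K) : A.applyExp ε = A.symbol ε * expXi ε := rfl

theorem coeff_symbol_one (A : PsiDO K) (m : ℕ+ →₀ ℕ) (k : ℤ) :
    (MvPowerSeries.coeff m (A.symbol 1)).coeff k = MvPowerSeries.coeff m (A.coeff (-k)) := by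
  rw [symbol, coeff_ofSpecCoeff, one_zpow, Units.val_one, one_smul]

theorem applyExp_add (A B : PsiDO K) : (A + B).applyExp 1 = A.applyExp 1 + B.applyExp 1 := by
  simp only [applyExp_eq, ← add_mul]
  congr 1
  ext m k
  simp only [map_add, HahnSeries.coeff_add, coeff_symbol_one, add_coeff]

theorem applyExp_zero : (0 : PsiDO K).applyExp 1 = 0 := by
  simpa using applyExp_add (0 : PsiDO K) 0

theorem applyExp_neg (A : PsiDO K) : (-A).applyExp 1 = -A.applyExp 1 := by
  rw [eq_neg_iff_add_eq_zero, ← applyExp_add, neg_add_cancel, applyExp_zero]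

theorem applyExp_sum {ι : Type*} (s : Finset ι) (A : ι → PsiDO K) :
    (∑ i ∈ s, A i).applyExp 1 = ∑ i ∈ s, (A i).applyExp 1 :=
  map_sum (⟨⟨fun A => A.applyExp 1, applyExp_zero⟩, applyExp_add⟩ : PsiDO K →+ SpecFn K) A s

theorem applyExp_monomial_zero_mul (a : TimeFn K) (A : PsiDO K) :
    (monomial a 0 * A).applyExp 1 = embed a * A.applyExp 1 := by
  classical
  simp only [applyExp_eq, ← mul_assoc]
  congr 1
  ext m k
  rw [coeff_symbol_one, monomial_zero_mul_coeff, coeff_embed_mul, coeff_mul, laurent_coeff_sum]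
  simp only [HahnSeries.coeff_smul, coeff_symbol_one, smul_eq_mul]

/-- Differentiating the exponential multiplies the symbol by `z ^ n`, which is right multiplication
of `A` by `D n`. -/
theorem pderiv_applyExp [CharZero K] (n : ℕ+) (A : PsiDO K) :
    pderiv (LaurentSeries K) n (A.applyExp 1) = (A.timeDeriv n + A * D n).applyExp 1 := by
  rw [applyExp_add, applyExp_eq, applyExp_eq, applyExp_eq, Derivation.leibniz, pderiv_expXi,
    smul_eq_mul, smul_eq_mul, add_comm, mul_comm (expXi 1)]
  congr 1
  · congr 1
    ext m k
    rw [coeff_symbol_one, timeDeriv_coeff, coeff_pderiv, coeff_pderiv, ← coeff_symbol_one,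
      ← Nat.cast_add_one, ← Nat.cast_add_one, ← nsmul_eq_mul',
      ← nsmul_eq_mul']
    rfl
  · rw [← mul_assoc]
    congr 1
    ext m k
    rw [mul_comm, coeff_C_mul, specVar, HahnSeries.single_pow, Units.val_one, Int.cast_one,
      one_mul, one_pow, HahnSeries.coeff_single_mul, one_mul, coeff_symbol_one, coeff_symbol_one,
      mul_D_coeff]
    congr 2
    simp
    ring

theorem applyExp_D_mul [CharZero K] (A : PsiDO K) :
    (D 1 * A).applyExp 1 = pderiv (LaurentSeries K) 1 (A.applyExp 1) := by
  rw [pderiv_applyExp, D_one_mul]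
  rfl

/-- The exponentials cancel and a residue of a product of symbols remains. The signs in `D ^ j (exp
(-ξ)) = (-z) ^ j exp (-ξ)` are those of `residue_mul`. -/
theorem specIntegral_applyExp [CharZero K] (P A : PsiDO K) :
    specIntegral (P.applyExp 1 * A.adjoint.applyExp (-1)) = (P * A).coeff (-1) := by
  obtain ⟨N, hN⟩ := P.exists_orderLE
  obtain ⟨M, hM⟩ := A.exists_orderLE
  rw [applyExp_eq, applyExp_eq, mul_mul_mul_comm, expXi_mul_expXi_neg, mul_one, symbol, symbol,
    specIntegral_ofSpecCoeff_mul (N := N) (M := M), residue_mul hN hM]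
  · refine Finset.sum_congr rfl fun i _ => ?_
    rw [one_zpow, Units.val_one, one_smul]
    rfl
  · intro i hi
    rw [hN i hi, smul_zero]
  · intro i hi
    rw [hM.adjoint i hi, smul_zero]

end PsiDO

/-! ### Two multi-times -/

/-- The pair of exponents `(a, b)` as an exponent in the pair of multi-times. -/
def joinExp (a b : ℕ+ →₀ ℕ) : ℕ+ ⊕ ℕ+ →₀ ℕ :=
  Finsupp.embDomain Function.Embedding.inl a + Finsupp.embDomain Function.Embedding.inr b

theorem joinExp_inl (a b : ℕ+ →₀ ℕ) (i : ℕ+) : joinExp a b (Sum.inl i) = a i := by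
  have h1 := Finsupp.embDomain_apply_self (Function.Embedding.inl : ℕ+ ↪ ℕ+ ⊕ ℕ+) a i
  have h2 := Finsupp.embDomain_of_notMem_range (Function.Embedding.inr : ℕ+ ↪ ℕ+ ⊕ ℕ+) b (Sum.inl i)
    (by simp)
  rw [joinExp, Finsupp.add_apply, h2, add_zero]
  exact h1

theorem joinExp_inr (a b : ℕ+ →₀ ℕ) (i : ℕ+) : joinExp a b (Sum.inr i) = b i := by
  have h1 := Finsupp.embDomain_apply_self (Function.Embedding.inr : ℕ+ ↪ ℕ+ ⊕ ℕ+) b i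
  have h2 := Finsupp.embDomain_of_notMem_range (Function.Embedding.inl : ℕ+ ↪ ℕ+ ⊕ ℕ+) a (Sum.inr i)
    (by simp)
  rw [joinExp, Finsupp.add_apply, h2, zero_add]
  exact h1

theorem joinExp_inj {a b a' b' : ℕ+ →₀ ℕ} (h : joinExp a b = joinExp a' b') : a = a' ∧ b = b' :=
  ⟨Finsupp.ext fun i => by rw [← joinExp_inl a b, h, joinExp_inl],
    Finsupp.ext fun i => by rw [← joinExp_inr a b, h, joinExp_inr]⟩

theorem exists_eq_joinExp (m : ℕ+ ⊕ ℕ+ →₀ ℕ) : ∃ a b, m = joinExp a b := by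
  refine ⟨m.comapDomain Sum.inl Sum.inl_injective.injOn,
    m.comapDomain Sum.inr Sum.inr_injective.injOn, Finsupp.ext ?_⟩
  rintro (i | i)
  · rw [joinExp_inl]; rfl
  · rw [joinExp_inr]; rfl

theorem coeff_atFirst_eq_zero {R : Type*} [CommRing R] (f : MvPowerSeries ℕ+ R)
    {m : ℕ+ ⊕ ℕ+ →₀ ℕ}
    (h : m ∉ Set.range (Finsupp.embDomain (Function.Embedding.inl : ℕ+ ↪ ℕ+ ⊕ ℕ+))) :
    coeff m (atFirst f) = 0 :=
  coeff_rename_eq_zero _ _ fun ⟨a, ha⟩ => h ⟨a, by rw [Finsupp.embDomain_eq_mapDomain, ha]⟩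

theorem coeff_atSecond_eq_zero {R : Type*} [CommRing R] (f : MvPowerSeries ℕ+ R)
    {m : ℕ+ ⊕ ℕ+ →₀ ℕ}
    (h : m ∉ Set.range (Finsupp.embDomain (Function.Embedding.inr : ℕ+ ↪ ℕ+ ⊕ ℕ+))) :
    coeff m (atSecond f) = 0 :=
  coeff_rename_eq_zero _ _ fun ⟨a, ha⟩ => h ⟨a, by rw [Finsupp.embDomain_eq_mapDomain, ha]⟩

/-- An exponent splits uniquely into its `t` and `t'` parts, so one term of the convolution
survives. -/
theorem coeff_joinExp_mul {R : Type*} [CommRing R] (f g : MvPowerSeries ℕ+ R) (a b : ℕ+ →₀ ℕ) :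
    coeff (joinExp a b) (atFirst f * atSecond g) = coeff a f * coeff b g := by
  classical
  rw [coeff_mul, Finset.sum_eq_single (Finsupp.embDomain Function.Embedding.inl a,
    Finsupp.embDomain Function.Embedding.inr b)]
  · rw [atFirst, atSecond, coeff_embDomain_rename, coeff_embDomain_rename]
  · rintro ⟨p, q⟩ hp hne
    by_cases h1 : p ∈ Set.range
        (Finsupp.embDomain (Function.Embedding.inl : ℕ+ ↪ ℕ+ ⊕ ℕ+) (M := ℕ))
    · by_cases h2 : q ∈ Set.range
          (Finsupp.embDomain (Function.Embedding.inr : ℕ+ ↪ ℕ+ ⊕ ℕ+) (M := ℕ))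
      · obtain ⟨a', rfl⟩ := h1
        obtain ⟨b', rfl⟩ := h2
        rw [Finset.HasAntidiagonal.mem_antidiagonal, ← joinExp] at hp
        obtain ⟨rfl, rfl⟩ := joinExp_inj hp
        exact absurd rfl hne
      · rw [coeff_atSecond_eq_zero g h2, mul_zero]
    · rw [coeff_atFirst_eq_zero f h1, zero_mul]
  · intro h
    exact absurd (Finset.HasAntidiagonal.mem_antidiagonal.mpr (by rw [joinExp])) h

theorem coeff_joinExp_atFirst {R : Type*} [CommRing R] (f : MvPowerSeries ℕ+ R)
    (a b : ℕ+ →₀ ℕ) : coeff (joinExp a b) (atFirst f) = if b = 0 then coeff a f else 0 := by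
  classical
  have h := coeff_joinExp_mul f 1 a b
  rw [atSecond, map_one, mul_one, coeff_one] at h
  rw [h, mul_ite, mul_one, mul_zero]

/-! ### Orthogonality -/

/-- The Hirota identity, coefficient by coefficient. -/
def Ortho (φ χ : SpecFn K) : Prop :=
  ∀ m m' : ℕ+ →₀ ℕ, (coeff m φ * coeff m' χ).coeff 1 = 0

theorem hirotaIdentity_iff (φ χ : SpecFn K) : HirotaIdentity φ χ ↔ Ortho φ χ := by
  constructor
  · intro h m m'
    rw [← coeff_joinExp_mul, ← coeff_specIntegral, h, map_zero]
  · intro h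
    refine MvPowerSeries.ext fun m => ?_
    obtain ⟨a, b, rfl⟩ := exists_eq_joinExp m
    rw [coeff_specIntegral, coeff_joinExp_mul, h, map_zero]

theorem Ortho.symm {φ χ : SpecFn K} (h : Ortho φ χ) : Ortho χ φ := fun m m' => by
  rw [mul_comm, h]

theorem Ortho.add {φ φ' χ : SpecFn K} (h : Ortho φ χ) (h' : Ortho φ' χ) : Ortho (φ + φ') χ :=
  fun m m' => by rw [map_add, add_mul, HahnSeries.coeff_add, h, h', add_zero]

theorem Ortho.neg {φ χ : SpecFn K} (h : Ortho φ χ) : Ortho (-φ) χ :=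
  fun m m' => by rw [map_neg, neg_mul, HahnSeries.coeff_neg, h, neg_zero]

theorem Ortho.zero (χ : SpecFn K) : Ortho 0 χ :=
  fun m m' => by rw [map_zero, zero_mul, HahnSeries.coeff_zero]

theorem Ortho.sum {ι : Type*} {χ : SpecFn K} {s : Finset ι} {φ : ι → SpecFn K}
    (h : ∀ i ∈ s, Ortho (φ i) χ) : Ortho (∑ i ∈ s, φ i) χ :=
  Finset.sum_induction φ (fun φ => Ortho φ χ) (fun _ _ => Ortho.add) (Ortho.zero χ) h

theorem Ortho.pderiv {φ χ : SpecFn K} (h : Ortho φ χ) (n : ℕ+) :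
    Ortho (pderiv (LaurentSeries K) n φ) χ := fun m m' => by
  -- The factor from differentiation is read as a natural multiple, which commutes with taking
  -- Laurent coefficients.
  rw [coeff_pderiv, ← Nat.cast_add_one, ← nsmul_eq_mul', smul_mul_assoc, HahnSeries.coeff_smul,
    h, smul_zero]

theorem Ortho.embed_mul {φ χ : SpecFn K} (h : Ortho φ χ) (a : TimeFn K) :
    Ortho (embed a * φ) χ := fun m m' => by
  classical
  rw [coeff_embed_mul, Finset.sum_mul, laurent_coeff_sum]
  exact Finset.sum_eq_zero fun p _ => by
    rw [← HahnSeries.C_mul_eq_smul, mul_assoc, HahnSeries.C_mul_eq_smul, HahnSeries.coeff_smul, h,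
      smul_zero]

theorem Ortho.specIntegral_mul_eq_zero {φ χ : SpecFn K} (h : Ortho φ χ) :
    specIntegral (φ * χ) = 0 := by
  classical
  ext m
  rw [coeff_specIntegral, coeff_mul, laurent_coeff_sum, map_zero]
  exact Finset.sum_eq_zero fun p _ => h _ _

/-! ### From the spectral identity to the Hirota identity -/

theorem coeff_leftCoeff (S : BispecFn K) (i : ℤ) (m : ℕ+ →₀ ℕ) (k : ℤ) :
    (coeff m (S.leftCoeff i)).coeff k = coeff m (S.coeff i (-k)) := rfl

theorem coeff_rightCoeff (S : BispecFn K) (j : ℤ) (m : ℕ+ →₀ ℕ) (k : ℤ) :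
    (coeff m (S.rightCoeff j)).coeff k = coeff m (S.coeff (-k) j) := rfl

theorem spectralIdentity_iff (ψ : SpecFn K) (S : BispecFn K) : SpectralIdentity ψ S ↔
    ∀ (i : ℤ) (a b : ℕ+ →₀ ℕ), (if b = 0 then (coeff a ψ).coeff (-i) else 0) =
      -(coeff a ψ * coeff b (S.leftCoeff i)).coeff 1 := by
  refine forall_congr' fun i => ?_
  have key (a b : ℕ+ →₀ ℕ) : coeff (joinExp a b) (atFirst (specCoeff i ψ)) =
        coeff (joinExp a b) (-specIntegral (atFirst ψ * atSecond (S.leftCoeff i))) ↔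
      (if b = 0 then (coeff a ψ).coeff (-i) else 0) =
        -(coeff a ψ * coeff b (S.leftCoeff i)).coeff 1 := by
    rw [coeff_joinExp_atFirst, map_neg, coeff_specIntegral, coeff_joinExp_mul, coeff_specCoeff]
  constructor
  · intro h a b
    rw [← key, h]
  · intro h
    refine MvPowerSeries.ext fun m => ?_
    obtain ⟨a, b, rfl⟩ := exists_eq_joinExp m
    exact (key a b).mpr (h a b)

theorem adjointSpectralIdentity_iff (ψs : SpecFn K) (S : BispecFn K) :
    AdjointSpectralIdentity ψs S ↔
    ∀ (j : ℤ) (a b : ℕ+ →₀ ℕ), (if b = 0 then (coeff a ψs).coeff (-j) else 0) =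
      (coeff a ψs * coeff b (S.rightCoeff j)).coeff 1 := by
  refine forall_congr' fun j => ?_
  have key (a b : ℕ+ →₀ ℕ) : coeff (joinExp a b) (atFirst (specCoeff j ψs)) =
        coeff (joinExp a b) (specIntegral (atFirst ψs * atSecond (S.rightCoeff j))) ↔
      (if b = 0 then (coeff a ψs).coeff (-j) else 0) =
        (coeff a ψs * coeff b (S.rightCoeff j)).coeff 1 := by
    rw [coeff_joinExp_atFirst, coeff_specIntegral, coeff_joinExp_mul, coeff_specCoeff]
  constructor
  · intro h a b
    rw [← key, h]
  · intro h
    refine MvPowerSeries.ext fun m => ?_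
    obtain ⟨a, b, rfl⟩ := exists_eq_joinExp m
    exact (key a b).mpr (h a b)

theorem pderiv_leftCoeff {ψ ψs : SpecFn K} {S : BispecFn K} (hS : IsPotential ψ ψs S) (i : ℤ) :
    pderiv (LaurentSeries K) 1 (S.leftCoeff i) = embed (specCoeff i ψ) * ψs := by
  classical
  ext m k
  have h := congrArg (coeff m) (hS i (-k))
  rw [coeff_pderiv, ← Nat.cast_add_one, ← nsmul_eq_mul', coeff_mul] at h
  rw [coeff_pderiv, ← Nat.cast_add_one, ← nsmul_eq_mul', HahnSeries.coeff_smul, coeff_leftCoeff, h,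
    coeff_embed_mul, laurent_coeff_sum]
  refine Finset.sum_congr rfl fun p _ => ?_
  rw [HahnSeries.coeff_smul, coeff_specCoeff _ ψs, neg_neg, smul_eq_mul]

theorem ortho_of_spectralIdentity {ψ ψs : SpecFn K} {S : BispecFn K}
    (h0 : constantCoeff (specCoeff 0 ψ) = 1) (hS : IsPotential ψ ψs S)
    (h : SpectralIdentity ψ S) : Ortho ψ ψs := by
  rw [spectralIdentity_iff] at h
  have h1 : Ortho (pderiv (LaurentSeries K) 1 (S.leftCoeff 0)) ψ := fun m m' => by
    -- This `t'`-exponent is nonzero, so the left side of the spectral identity has no such term.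
    have h2 := h 0 m' (m + Finsupp.single 1 1)
    rw [if_neg (fun h3 => by simpa using DFunLike.congr_fun h3 1), eq_comm, neg_eq_zero] at h2
    rw [coeff_pderiv, ← Nat.cast_add_one, ← nsmul_eq_mul', smul_mul_assoc, HahnSeries.coeff_smul,
      mul_comm, h2, smul_zero]
  rw [pderiv_leftCoeff hS] at h1
  -- The row of index 0 has derivative `specCoeff 0 ψ * ψs`, and its first factor is a unit that
  -- depends on `t` only.
  have h2 := h1.embed_mul (specCoeff 0 ψ)⁻¹
  rw [← mul_assoc, ← map_mul, MvPowerSeries.inv_mul_cancel _ (by rw [h0]; exact one_ne_zero),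
    map_one, one_mul] at h2
  exact h2.symm

/-! ### The dressing operator of a wave function -/

namespace PsiDO

/-- The operator `∑ j ≥ 0, w j * (ε * D) ^ (-j)`. -/
def ofWave (ε : ℤˣ) (w : ℕ → TimeFn K) : PsiDO K where
  coeff i := ((ε ^ i : ℤˣ) : ℤ) • if i ≤ 0 then w (-i).toNat else 0
  bounded := ⟨0, fun i hi => by rw [if_neg (not_le.mpr hi), smul_zero]⟩

theorem ofWave_coeff (ε : ℤˣ) (w : ℕ → TimeFn K) (i : ℤ) : (ofWave ε w).coeff i =
    ((ε ^ i : ℤˣ) : ℤ) • if i ≤ 0 then w (-i).toNat else 0 := rfl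

theorem ofWave_orderLE (ε : ℤˣ) (w : ℕ → TimeFn K) : (ofWave ε w).OrderLE 0 :=
  fun i hi => by rw [ofWave_coeff, if_neg (not_le.mpr hi), smul_zero]

theorem ofWave_coeff_zero (ε : ℤˣ) {w : ℕ → TimeFn K} (hw : w 0 = 1) :
    (ofWave ε w).coeff 0 = 1 := by
  simp [ofWave_coeff, hw]

theorem ofWave_applyExp (ε : ℤˣ) (w : ℕ → TimeFn K) :
    (ofWave ε w).applyExp ε = waveFn ε w := by
  rw [applyExp_eq, waveFn, mul_comm, symbol, inverseSeries]
  congr 2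
  funext i
  rw [ofWave_coeff, smul_smul, ← Units.val_mul, ← mul_zpow, Int.units_mul_self, one_zpow, Units.val_one,
    one_smul]

theorem adjoint_coeff_self {A : PsiDO K} (hA : A.OrderLE 0) :
    A.adjoint.coeff 0 = A.coeff 0 := by
  simpa using adjoint_coeff hA 0

theorem ortho_D_mul [CharZero K] {A : PsiDO K} {χ : SpecFn K} (h : Ortho (A.applyExp 1) χ)
    (k : ℕ) : Ortho ((D k * A).applyExp 1) χ := by
  induction k with
  | zero => rwa [Nat.cast_zero, ← one_eq_D, one_mul]
  | succ k ih =>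
    rw [Nat.cast_succ, add_comm, ← D_mul_D, mul_assoc, applyExp_D_mul]
    exact ih.pderiv 1

theorem plus_eq_cut (A : PsiDO K) : A.plus = A.cut 0 := rfl

theorem plus_add_minus (A : PsiDO K) : A.plus + A.minus = A := by
  ext1
  funext i
  rw [add_coeff]
  rcases lt_or_ge i 0 with h | h
  · simp [plus, minus, h, not_le.mpr h]
  · simp [plus, minus, h, not_lt.mpr h]

theorem minus_orderLE (A : PsiDO K) : A.minus.OrderLE (-1) :=
  fun i hi => if_neg (by omega)

/-- A differential operator acts through `t₁`-derivatives and multiplication by functions of `t`,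
and both preserve orthogonality to `χ`. -/
theorem ortho_plus_mul [CharZero K] {A : PsiDO K} {χ : SpecFn K} (h : Ortho (A.applyExp 1) χ)
    (B : PsiDO K) : Ortho ((B.plus * A).applyExp 1) χ := by
  obtain ⟨N, hN⟩ := B.exists_orderLE
  rw [plus_eq_cut, cut_eq_sum hN, Finset.sum_mul, applyExp_sum]
  refine Ortho.sum fun i hi => ?_
  obtain ⟨k, rfl⟩ := Int.eq_ofNat_of_zero_le (Finset.mem_Icc.mp hi).1
  rw [← monomial_zero_mul_D, mul_assoc, applyExp_monomial_zero_mul]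
  exact (ortho_D_mul h k).embed_mul _

theorem mul_coeff_eq_zero_of_ortho [CharZero K] {A V : PsiDO K}
    (h : Ortho (A.applyExp 1) (V.adjoint.applyExp (-1))) (i : ℤ) (hi : i < 0) :
    (A * V).coeff i = 0 := by
  refine coeff_eq_zero_of_residue (fun k => ?_) i hi
  rw [← mul_assoc, ← specIntegral_applyExp]
  exact (ortho_D_mul h k).specIntegral_mul_eq_zero

theorem eq_zero_of_orderLE_neg {A : PsiDO K} (h : A.OrderLE (-1))
    (h' : ∀ i < 0, A.coeff i = 0) : A = 0 := by
  ext1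
  funext i
  rcases lt_or_ge i 0 with hi | hi
  · exact h' i hi
  · exact h i (by omega)

/-! ### Invertibility of the dressing operator, Wilson–Sato and Lax equations. -/

theorem mul_eq_one_of_ortho [CharZero K] {W V : PsiDO K} (hW : W.OrderLE 0) (hW1 : W.coeff 0 = 1)
    (hV : V.OrderLE 0) (hV1 : V.coeff 0 = 1)
    (h : Ortho (W.applyExp 1) (V.adjoint.applyExp (-1))) : W * V = 1 ∧ V * W = 1 := by
  have h1 : W * V = 1 := by
    rw [← sub_eq_zero]
    refine eq_zero_of_orderLE_neg (fun i hi => ?_) fun i hi => ?_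
    · rcases eq_or_lt_of_le (show 0 ≤ i by omega) with rfl | hi
      · have := mul_coeff_add hW hV
        rw [add_zero, hW1, hV1, one_mul] at this
        rw [sub_coeff, this, one_coeff, if_pos rfl, sub_self]
      · rw [sub_coeff, hW.mul hV i (by simpa using hi), one_coeff, if_neg hi.ne', sub_self]
    · rw [sub_coeff, mul_coeff_eq_zero_of_ortho h i hi, one_coeff, if_neg hi.ne, sub_self]
  -- The right inverse is two-sided because `W * (V * W - 1) = 0` and `W` is monic.
  refine ⟨h1, sub_eq_zero.mp (eq_zero_of_monic_mul_eq_zero hW hW1 ?_)⟩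
  rw [mul_sub, ← mul_assoc, h1, one_mul, mul_one, sub_self]

theorem timeDeriv_eq_of_ortho [CharZero K] {W V : PsiDO K} (hW : W.OrderLE 0)
    (hW1 : W.coeff 0 = 1) (hV : V.OrderLE 0) (h1 : W * V = 1) (h2 : V * W = 1)
    (h : Ortho (W.applyExp 1) (V.adjoint.applyExp (-1))) (n : ℕ+) :
    W.timeDeriv n = -((W * D n * V).minus * W) := by
  set L := W * D n * V with hL
  have hLW : L * W = W * D n := by rw [hL, mul_assoc, h2, mul_one]
  -- Multiplication by `V` cancels the differential part of `L`. What is left has order at most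
  -- `-1`, since the leading coefficient 1 of `W` has zero derivative.
  have hPV : (W.timeDeriv n + W * D n - L.plus * W) * V = W.timeDeriv n * V + L.minus := by
    rw [sub_mul, add_mul, mul_assoc L.plus, h1, mul_one, ← hL]
    nth_rw 1 [← L.plus_add_minus]
    abel
  have hWn : (W.timeDeriv n).OrderLE (-1) := fun i hi => by
    rcases eq_or_lt_of_le (show 0 ≤ i by omega) with rfl | hi
    · rw [timeDeriv_coeff, hW1, pderiv_one]
    · exact hW.timeDeriv n i hi
  have hP : W.timeDeriv n + W * D n - L.plus * W = 0 := by
    have hPV0 : (W.timeDeriv n + W * D n - L.plus * W) * V = 0 := by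
      refine eq_zero_of_orderLE_neg ?_ fun i hi => mul_coeff_eq_zero_of_ortho ?_ i hi
      · rw [hPV]
        exact OrderLE.add (by simpa using hWn.mul hV) L.minus_orderLE
      · rw [sub_eq_add_neg, applyExp_add, applyExp_neg, ← pderiv_applyExp]
        exact (h.pderiv n).add (ortho_plus_mul h L).neg
    rw [← mul_one (_ - _), ← h2, ← mul_assoc, hPV0, zero_mul]
  have hsplit : L.plus * W + L.minus * W = W * D n := by
    rw [← add_mul, plus_add_minus, hLW]
  rw [← hsplit] at hP
  rw [eq_neg_iff_add_eq_zero, ← hP]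
  abel

/-- Differentiating `V * W = 1` gives the evolution of `V`, hence a commutator with minus the
negative part. Conjugates of powers of `D` commute, so this is the commutator with the positive
part. -/
theorem timeDeriv_lax {W V : PsiDO K} (h1 : W * V = 1) (h2 : V * W = 1) (n : ℕ+)
    (hW : W.timeDeriv n = -((W * D n * V).minus * W)) (r : ℤ) :
    (W * D r * V).timeDeriv n =
      (W * D n * V).plus * (W * D r * V) - W * D r * V * (W * D n * V).plus := by
  have hV : V.timeDeriv n = V * (W * D n * V).minus := by
    have h := congrArg (timeDeriv n) h2
    rw [timeDeriv_mul, one_eq_D, timeDeriv_D, hW] at h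
    have h' : V.timeDeriv n * W * V = V * ((W * D n * V).minus * W) * V := by
      rw [mul_neg, ← sub_eq_add_neg, sub_eq_zero] at h
      rw [h]
    rwa [mul_assoc, h1, mul_one, ← mul_assoc V, mul_assoc _ W, h1, mul_one] at h'
  have hcomm : W * D n * V * (W * D r * V) = W * D r * V * (W * D n * V) := by
    have key (a b : ℤ) : W * D a * V * (W * D b * V) = W * D (a + b) * V := by
      rw [← D_mul_D, mul_assoc (W * D a), mul_assoc W (D b), ← mul_assoc V, h2, one_mul,
        ← mul_assoc, ← mul_assoc, mul_assoc W (D a)]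
    rw [key, key, add_comm]
  rw [timeDeriv_mul, timeDeriv_mul, timeDeriv_D, mul_zero, add_zero, hW, hV]
  have hplus : (W * D n * V).plus = W * D n * V - (W * D n * V).minus :=
    eq_sub_of_add_eq (plus_add_minus _)
  rw [hplus, sub_mul, mul_sub, hcomm]
  noncomm_ring

end PsiDO

theorem isBakerAkhiezerPair_of_ortho [CharZero K] {w ws : ℕ → TimeFn K} (hw : w 0 = 1)
    (hws : ws 0 = 1) (h : Ortho (waveFn 1 w) (waveFn (-1) ws)) :
    IsBakerAkhiezerPair (waveFn 1 w) (waveFn (-1) ws) := by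
  -- `V` is taken as an adjoint so that its own adjoint produces the given ψ*.
  set W := PsiDO.ofWave 1 w
  set V := (PsiDO.ofWave (-1) ws).adjoint with hVdef
  have hW : W.OrderLE 0 := PsiDO.ofWave_orderLE 1 w
  have hW1 : W.coeff 0 = 1 := PsiDO.ofWave_coeff_zero 1 hw
  have hV : V.OrderLE 0 := (PsiDO.ofWave_orderLE (-1) ws).adjoint
  have hV1 : V.coeff 0 = 1 := by
    rw [PsiDO.adjoint_coeff_self (PsiDO.ofWave_orderLE (-1) ws), PsiDO.ofWave_coeff_zero _ hws]
  have hVs : V.adjoint.applyExp (-1) = waveFn (-1) ws := by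
    rw [hVdef, PsiDO.adjoint_adjoint, PsiDO.ofWave_applyExp]
  have hWs : W.applyExp 1 = waveFn 1 w := PsiDO.ofWave_applyExp 1 w
  rw [← hVs, ← hWs] at h
  obtain ⟨h1, h2⟩ := PsiDO.mul_eq_one_of_ortho hW hW1 hV hV1 h
  have hev := PsiDO.timeDeriv_eq_of_ortho hW hW1 hV h1 h2 h
  refine ⟨W, V, ⟨hW1, hW, h1, h2⟩, fun n i => ?_, fun r n i => ?_, hWs.symm, hVs.symm⟩
  · rw [hev n]
    rfl
  · have := congrArg (fun A => A.coeff i) (PsiDO.timeDeriv_lax h1 h2 n (hev n) r)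
    rwa [PsiDO.sub_coeff] at this

/-! ### The spans of the coefficients of the wave functions -/

theorem laurent_coeff_smul_mul (c : K) (f g : LaurentSeries K) (k : ℤ) :
    (c • f * g).coeff k = c * (f * g).coeff k := by
  rw [← HahnSeries.C_mul_eq_smul, mul_assoc, HahnSeries.C_mul_eq_smul, HahnSeries.coeff_smul,
    smul_eq_mul]

/-- The span of the coefficients of the monomials in the multi-time. -/
def coeffSpan (φ : SpecFn K) : Submodule K (LaurentSeries K) :=
  Submodule.span K (Set.range fun m : ℕ+ →₀ ℕ => coeff m φ)

theorem coeff_mem_coeffSpan (φ : SpecFn K) (m : ℕ+ →₀ ℕ) : coeff m φ ∈ coeffSpan φ :=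
  Submodule.subset_span ⟨m, rfl⟩

theorem Ortho.coeff_mul_eq_zero {φ χ : SpecFn K} (h : Ortho φ χ) {f g : LaurentSeries K}
    (hf : f ∈ coeffSpan φ) (hg : g ∈ coeffSpan χ) : (f * g).coeff 1 = 0 := by
  induction hf using Submodule.span_induction with
  | zero => rw [zero_mul, HahnSeries.coeff_zero]
  | add x y _ _ hx hy => rw [add_mul, HahnSeries.coeff_add, hx, hy, add_zero]
  | smul c x _ hx => rw [laurent_coeff_smul_mul, hx, mul_zero]
  | mem x hx =>
    obtain ⟨m, rfl⟩ := hx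
    induction hg using Submodule.span_induction with
    | zero => rw [mul_zero, HahnSeries.coeff_zero]
    | add x y _ _ hx hy => rw [mul_add, HahnSeries.coeff_add, hx, hy, add_zero]
    | smul c x _ hx => rw [mul_comm, laurent_coeff_smul_mul, mul_comm x, hx, mul_zero]
    | mem x hx =>
      obtain ⟨m', rfl⟩ := hx
      exact h m m'

/-- Gaussian elimination: the reduced elements of smaller degree clear the lower nonnegative powers
of the parameter without creating new ones. -/
theorem exists_reduced {X : Submodule K (LaurentSeries K)}
    (hX : ∀ k : ℕ, ∃ f ∈ X, f.coeff (-k) ≠ 0 ∧ ∀ i : ℤ, i < -k → f.coeff i = 0) (k : ℕ) :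
    ∃ v ∈ X, ∀ i ≤ 0, v.coeff i = if i = -k then 1 else 0 := by
  induction k using Nat.strong_induction_on with
  | _ k ih =>
    choose v hvX hv using ih
    obtain ⟨f, hfX, hf, hf0⟩ := hX k
    refine ⟨(f.coeff (-k))⁻¹ • (f - ∑ l : Fin k, f.coeff (-(l : ℕ)) • v l l.2),
      X.smul_mem _ (X.sub_mem hfX (X.sum_mem fun l _ => X.smul_mem _ (hvX _ _))), fun i hi => ?_⟩
    rw [HahnSeries.coeff_smul, HahnSeries.coeff_sub, laurent_coeff_sum]
    simp only [HahnSeries.coeff_smul, hv _ _ i hi, smul_eq_mul]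
    split_ifs with h
    · subst h
      rw [Finset.sum_eq_zero, sub_zero, inv_mul_cancel₀ hf]
      intro l _
      rw [if_neg (by have := l.2; omega), mul_zero]
    · rcases lt_or_ge i (-k) with h' | h'
      · rw [hf0 i h', Finset.sum_eq_zero, sub_zero, mul_zero]
        intro l _
        rw [if_neg (by have := l.2; omega), mul_zero]
      · rw [Finset.sum_eq_single ⟨(-i).toNat, by omega⟩, if_pos (by dsimp only; omega), mul_one,
          show -(((-i).toNat : ℕ) : ℤ) = i by omega, sub_self, mul_zero]
        · intro l _ hl
          rw [if_neg, mul_zero]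
          rintro rfl
          exact hl (Fin.ext (by simp))
        · intro h
          exact absurd (Finset.mem_univ _) h

theorem coeff_single_expXi (ε : ℤˣ) (a : ℕ) :
    coeff (Finsupp.single 1 a) (expXi ε : SpecFn K) =
      HahnSeries.single (-(a : ℤ)) ((Nat.factorial a : K)⁻¹ * ((ε : ℤ) : K) ^ a) := by
  rw [coeff_expXi, Finsupp.prod_single_index (by simp), specVar, PNat.one_coe, pow_one,
    ← map_intCast (HahnSeries.C : K →+* LaurentSeries K), HahnSeries.C_apply, HahnSeries.C_apply,
    HahnSeries.single_mul_single, HahnSeries.single_pow, HahnSeries.single_mul_single]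
  simp

theorem coeff_inverseSeries (w : ℕ → TimeFn K) (m : ℕ+ →₀ ℕ) (k : ℤ) :
    (coeff m (inverseSeries w)).coeff k = if 0 ≤ k then coeff m (w k.toNat) else 0 := by
  rw [inverseSeries, coeff_ofSpecCoeff, neg_neg]
  simp only [Left.neg_nonpos_iff]
  split_ifs <;> simp

theorem coeff_single_waveFn (ε : ℤˣ) (w : ℕ → TimeFn K) (k : ℕ) (i : ℤ) :
    (coeff (Finsupp.single 1 k) (waveFn ε w)).coeff i =
      ∑ p ∈ Finset.HasAntidiagonal.antidiagonal k,
        ((Nat.factorial p.1 : K)⁻¹ * ((ε : ℤ) : K) ^ p.1) *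
          (coeff (Finsupp.single 1 p.2) (inverseSeries w)).coeff (i + p.1) := by
  classical
  rw [waveFn, coeff_mul, Finsupp.antidiagonal_single, Finset.sum_map, laurent_coeff_sum]
  refine Finset.sum_congr rfl fun p _ => ?_
  change (coeff (Finsupp.single 1 p.1) (expXi ε) *
    coeff (Finsupp.single 1 p.2) (inverseSeries w)).coeff i = _
  rw [coeff_single_expXi, HahnSeries.coeff_single_mul, sub_neg_eq_add]

/-- The coefficient of `t₁ ^ k` works: its top term is `(ε z) ^ k / k!`, as the series in `w` has no
positive powers of `z`. -/
theorem exists_leading_waveFn [CharZero K] (ε : ℤˣ) {w : ℕ → TimeFn K} (hw : w 0 = 1) (k : ℕ) :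
    ∃ f ∈ coeffSpan (waveFn ε w), f.coeff (-k) ≠ 0 ∧ ∀ i : ℤ, i < -k → f.coeff i = 0 := by
  classical
  refine ⟨_, coeff_mem_coeffSpan _ (Finsupp.single 1 k), ?_, fun i hi => ?_⟩
  · rw [coeff_single_waveFn, Finset.sum_eq_single (k, 0)]
    · rw [coeff_inverseSeries, if_pos (by simp), neg_add_cancel, Int.toNat_zero, hw,
        Finsupp.single_zero, coeff_zero_one, mul_one]
      refine mul_ne_zero (inv_ne_zero (Nat.cast_ne_zero.mpr (Nat.factorial_ne_zero k)))
        (pow_ne_zero _ (Int.cast_ne_zero.mpr ε.ne_zero))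
    · rintro ⟨a, b⟩ hp h
      have := Finset.HasAntidiagonal.mem_antidiagonal.mp hp
      rw [coeff_inverseSeries, if_neg, mul_zero]
      intro h'
      apply h
      simp only [Prod.mk.injEq] at this h' ⊢
      omega
    · intro h
      exact absurd (Finset.HasAntidiagonal.mem_antidiagonal.mpr (add_zero k)) h
  · rw [coeff_single_waveFn]
    refine Finset.sum_eq_zero fun p hp => ?_
    have := Finset.HasAntidiagonal.mem_antidiagonal.mp hp
    rw [coeff_inverseSeries, if_neg (by omega), mul_zero]

theorem constantCoeff_specCoeff_waveFn (ε : ℤˣ) {w : ℕ → TimeFn K} (hw : w 0 = 1) :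
    constantCoeff (specCoeff 0 (waveFn ε w)) = 1 := by
  classical
  rw [← coeff_zero_eq_constantCoeff_apply, coeff_specCoeff, ← Finsupp.single_zero (1 : ℕ+),
    coeff_single_waveFn]
  simp [coeff_inverseSeries, hw]

/-! ### The potential -/

/-- With `v = z ^ k + v'` and `u = z ^ l + u'`, the product `v' * u'` starts at `z ^ (-2)`, so only
the cross terms have a residue. -/
theorem reduced_coeff_add {v u : LaurentSeries K} {k l : ℕ}
    (hv : ∀ i ≤ 0, v.coeff i = if i = -(k : ℤ) then 1 else 0)
    (hu : ∀ i ≤ 0, u.coeff i = if i = -(l : ℤ) then 1 else 0) :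
    (v * u).coeff 1 = v.coeff (1 + l) + u.coeff (1 + k) := by
  obtain ⟨v', rfl⟩ : ∃ v', v = HahnSeries.single (-(k : ℤ)) 1 + v' := ⟨_, (add_sub_cancel _ v).symm⟩
  obtain ⟨u', rfl⟩ : ∃ u', u = HahnSeries.single (-(l : ℤ)) 1 + u' := ⟨_, (add_sub_cancel _ u).symm⟩
  have hv' : ∀ i < 1, v'.coeff i = 0 := fun i hi => by
    have := hv i (by omega)
    rw [HahnSeries.coeff_add, HahnSeries.coeff_single] at this
    split_ifs at this <;> linear_combination this
  have hu' : ∀ i < 1, u'.coeff i = 0 := fun i hi => by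
    have := hu i (by omega)
    rw [HahnSeries.coeff_add, HahnSeries.coeff_single] at this
    split_ifs at this <;> linear_combination this
  have h1 : (v' * u').coeff 1 = 0 := by
    rw [laurent_coeff_mul hv' hu']
    simp
  rw [add_mul, mul_add, mul_add, HahnSeries.single_mul_single]
  simp only [HahnSeries.coeff_add, h1, HahnSeries.coeff_single_mul, HahnSeries.coeff_mul_single,
    HahnSeries.coeff_single, sub_neg_eq_add, one_mul, mul_one]
  rw [if_neg (by omega), if_neg (by omega), if_neg (by omega)]
  ring

/-- The value at `t = 0` of a solution of the spectral identities. -/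
theorem exists_initial_potential {φ χ : SpecFn K} (h : Ortho φ χ)
    (hφ : ∀ k : ℕ, ∃ v ∈ coeffSpan φ, ∀ i ≤ 0, v.coeff i = if i = -(k : ℤ) then 1 else 0)
    (hχ : ∀ k : ℕ, ∃ v ∈ coeffSpan χ, ∀ i ≤ 0, v.coeff i = if i = -(k : ℤ) then 1 else 0) :
    ∃ s : ℤ → ℤ → K,
      (∀ i, ∃ r ∈ coeffSpan χ, ∀ j, s i j = r.coeff (-j) - if j = -i - 1 then 1 else 0) ∧
      (∀ j, ∃ r ∈ coeffSpan φ, ∀ i, s i j = r.coeff (-i) + if i = -j - 1 then 1 else 0) := by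
  choose v hvX hv using hφ
  choose u huX hu using hχ
  have huv (k l : ℕ) : (v k).coeff (1 + l) + (u l).coeff (1 + k) = 0 := by
    rw [← reduced_coeff_add (hv k) (hu l), h.coeff_mul_eq_zero (hvX k) (huX l)]
  -- The factor 2 reconciles the opposite signs required in rows and columns: for `i < 0` the
  -- leading term of `2 u` turns `-1` into `+1` on the antidiagonal `i + j = -1`.
  refine ⟨fun i j => (if i < 0 then 2 * (u (-1 - i).toNat).coeff (-j) else 0) -
    if j = -i - 1 then 1 else 0, fun i => ?_, fun j => ?_⟩
  · by_cases hi : i < 0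
    · refine ⟨(2 : K) • u (-1 - i).toNat, Submodule.smul_mem _ _ (huX _), fun j => ?_⟩
      beta_reduce
      rw [if_pos hi, HahnSeries.coeff_smul, smul_eq_mul]
    · exact ⟨0, Submodule.zero_mem _, fun j => by beta_reduce; rw [if_neg hi, HahnSeries.coeff_zero]⟩
  · by_cases hj : 0 ≤ j
    · refine ⟨0, Submodule.zero_mem _, fun i => ?_⟩
      beta_reduce
      rw [HahnSeries.coeff_zero, hu _ _ (by omega)]
      by_cases hi : i = -j - 1
      · rw [if_pos (by omega), if_pos (by omega), if_pos (by omega), if_pos hi]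
        ring
      · rw [if_neg hi, if_neg (c := j = -i - 1) (by omega)]
        by_cases hi' : i < 0
        · rw [if_pos hi', if_neg (by omega)]
          ring
        · rw [if_neg hi']
          ring
    · refine ⟨(-2 : K) • v (-1 - j).toNat, Submodule.smul_mem _ _ (hvX _), fun i => ?_⟩
      beta_reduce
      rw [HahnSeries.coeff_smul, smul_eq_mul]
      by_cases hi : i < 0
      -- For `i, j < 0` orthogonality turns the tail of `2 u` into that of `-2 v`.
      · have := huv (-1 - j).toNat (-1 - i).toNat
        rw [show (1 : ℤ) + (-1 - i).toNat = -i by omega,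
          show (1 : ℤ) + (-1 - j).toNat = -j by omega] at this
        rw [if_pos hi, if_neg (by omega), if_neg (by omega)]
        linear_combination 2 * this
      · rw [if_neg hi, hv _ _ (by omega)]
        by_cases hi' : i = -j - 1
        · rw [if_pos (by omega), if_pos (by omega), if_pos hi']
          ring
        · rw [if_neg (by omega), if_neg (by omega), if_neg hi']
          ring

/-- The antiderivative with respect to the first time, without constant term in that time. -/
def antideriv (f : TimeFn K) : TimeFn K := fun m =>
  if m 1 = 0 then 0 else (m 1 : K)⁻¹ * coeff (m - Finsupp.single 1 1) f

theorem coeff_antideriv (f : TimeFn K) (m : ℕ+ →₀ ℕ) : coeff m (antideriv f) =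
    if m 1 = 0 then 0 else (m 1 : K)⁻¹ * coeff (m - Finsupp.single 1 1) f := rfl

theorem pderiv_antideriv [CharZero K] (f : TimeFn K) : pderiv K 1 (antideriv f) = f := by
  ext m
  have h : (m 1 : K) + 1 ≠ 0 := Nat.cast_add_one_ne_zero _
  rw [coeff_pderiv, coeff_antideriv, if_neg (by simp), add_tsub_cancel_right]
  simp only [Finsupp.add_apply, Finsupp.single_eq_same, Nat.cast_add, Nat.cast_one]
  field_simp

/-- The coefficient is a combination of `t`-coefficients of `χ` with scalars independent of `j`, so
the antiderivative adds nothing to a pairing with the orthogonal wave function. -/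
theorem coeff_antideriv_mul_specCoeff (f : TimeFn K) (χ : SpecFn K) (m : ℕ+ →₀ ℕ) :
    ∃ r ∈ coeffSpan χ, ∀ j, coeff m (antideriv (f * specCoeff j χ)) = r.coeff (-j) := by
  classical
  by_cases hm : m 1 = 0
  · exact ⟨0, Submodule.zero_mem _, fun j => by rw [coeff_antideriv, if_pos hm, HahnSeries.coeff_zero]⟩
  · refine ⟨(m 1 : K)⁻¹ • ∑ p ∈ Finset.HasAntidiagonal.antidiagonal (m - Finsupp.single 1 1),
      coeff p.1 f • coeff p.2 χ, Submodule.smul_mem _ _ (Submodule.sum_mem _ fun p _ =>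
        Submodule.smul_mem _ _ (coeff_mem_coeffSpan χ _)), fun j => ?_⟩
    rw [coeff_antideriv, if_neg hm, coeff_mul, HahnSeries.coeff_smul, laurent_coeff_sum]
    simp only [HahnSeries.coeff_smul, coeff_specCoeff, smul_eq_mul]

theorem laurent_coeff_neg_bounded (r : LaurentSeries K) : ∃ N : ℤ, ∀ j, N < j → r.coeff (-j) = 0 :=
  ⟨-r.order, fun _ hj => HahnSeries.coeff_eq_zero_of_lt_order (by omega)⟩

theorem exists_potential_of_ortho [CharZero K] {φ χ : SpecFn K} (h : Ortho φ χ)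
    (hφ : ∀ k : ℕ, ∃ v ∈ coeffSpan φ, ∀ i ≤ 0, v.coeff i = if i = -(k : ℤ) then 1 else 0)
    (hχ : ∀ k : ℕ, ∃ v ∈ coeffSpan χ, ∀ i ≤ 0, v.coeff i = if i = -(k : ℤ) then 1 else 0) :
    ∃ S : BispecFn K, IsPotential φ χ S ∧ SpectralIdentity φ S ∧ AdjointSpectralIdentity χ S := by
  classical
  obtain ⟨s, hs1, hs2⟩ := exists_initial_potential h hφ hχ
  let c : ℤ → ℤ → TimeFn K := fun i j => C (s i j) + antideriv (specCoeff i φ * specCoeff j χ)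
  have hc1 (i : ℤ) (m : ℕ+ →₀ ℕ) : ∃ r ∈ coeffSpan χ, ∀ j, coeff m (c i j) = r.coeff (-j) -
      if m = 0 then (if j = -i - 1 then 1 else 0) else 0 := by
    obtain ⟨r, hr, hr'⟩ := hs1 i
    obtain ⟨q, hq, hq'⟩ := coeff_antideriv_mul_specCoeff (specCoeff i φ) χ m
    by_cases hm : m = 0
    · refine ⟨r + q, Submodule.add_mem _ hr hq, fun j => ?_⟩
      rw [map_add, hq', coeff_C, if_pos hm, if_pos hm, hr', HahnSeries.coeff_add]
      ring
    · exact ⟨q, hq, fun j => by rw [map_add, hq', coeff_C, if_neg hm, if_neg hm, zero_add, sub_zero]⟩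
  have hc2 (j : ℤ) (m : ℕ+ →₀ ℕ) : ∃ r ∈ coeffSpan φ, ∀ i, coeff m (c i j) = r.coeff (-i) +
      if m = 0 then (if i = -j - 1 then 1 else 0) else 0 := by
    obtain ⟨r, hr, hr'⟩ := hs2 j
    obtain ⟨q, hq, hq'⟩ := coeff_antideriv_mul_specCoeff (specCoeff j χ) φ m
    by_cases hm : m = 0
    · refine ⟨r + q, Submodule.add_mem _ hr hq, fun i => ?_⟩
      rw [map_add, mul_comm, hq', coeff_C, if_pos hm, if_pos hm, hr', HahnSeries.coeff_add]
      ring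
    · exact ⟨q, hq, fun i => by
        rw [map_add, mul_comm, hq', coeff_C, if_neg hm, if_neg hm, zero_add, add_zero]⟩
  let S : BispecFn K :=
    { coeff := c
      bounded_right := fun i m => by
        obtain ⟨r, -, hr⟩ := hc1 i m
        obtain ⟨N, hN⟩ := laurent_coeff_neg_bounded r
        refine ⟨max N (-i - 1), fun j hj => ?_⟩
        rw [hr, hN j (by omega), if_neg (c := j = -i - 1) (by omega), ite_self, sub_zero]
      bounded_left := fun j m => by
        obtain ⟨r, -, hr⟩ := hc2 j m
        obtain ⟨N, hN⟩ := laurent_coeff_neg_bounded r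
        refine ⟨max N (-j - 1), fun i hi => ?_⟩
        rw [hr, hN i (by omega), if_neg (c := i = -j - 1) (by omega), ite_self, add_zero] }
  refine ⟨S, fun i j => ?_, (spectralIdentity_iff φ S).mpr fun i a b => ?_,
    (adjointSpectralIdentity_iff χ S).mpr fun j a b => ?_⟩
  · change pderiv K 1 (c i j) = _
    rw [map_add, pderiv_C, zero_add, pderiv_antideriv]
  · obtain ⟨r, hr, hr'⟩ := hc1 i b
    have hrow : coeff b (S.leftCoeff i) =
        r - if b = 0 then HahnSeries.single (i + 1) 1 else 0 := by
      ext k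
      rw [coeff_leftCoeff, HahnSeries.coeff_sub]
      change coeff b (c i (-k)) = _
      rw [hr', neg_neg]
      congr 1
      split_ifs with h1 h2
      · rw [show k = i + 1 by omega, HahnSeries.coeff_single_same]
      · rw [HahnSeries.coeff_single_of_ne (by omega)]
      · rw [HahnSeries.coeff_zero]
    -- The part `r` pairs to zero. The monomial `μ ^ (-i - 1)`, present only at `b = 0`, extracts
    -- the coefficient of `μ ^ i` in ψ.
    rw [hrow, mul_sub, HahnSeries.coeff_sub,
      h.coeff_mul_eq_zero (coeff_mem_coeffSpan φ a) hr]
    split_ifs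
    · rw [HahnSeries.coeff_mul_single, show (1 : ℤ) - (i + 1) = -i by ring]
      ring
    · simp
  · obtain ⟨r, hr, hr'⟩ := hc2 j b
    have hcol : coeff b (S.rightCoeff j) =
        r + if b = 0 then HahnSeries.single (j + 1) 1 else 0 := by
      ext k
      rw [coeff_rightCoeff, HahnSeries.coeff_add]
      change coeff b (c (-k) j) = _
      rw [hr', neg_neg]
      congr 1
      split_ifs with h1 h2
      · rw [show k = j + 1 by omega, HahnSeries.coeff_single_same]
      · rw [HahnSeries.coeff_single_of_ne (by omega)]
      · rw [HahnSeries.coeff_zero]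
    rw [hcol, mul_add, HahnSeries.coeff_add,
      h.symm.coeff_mul_eq_zero (coeff_mem_coeffSpan χ a) hr]
    split_ifs
    · rw [HahnSeries.coeff_mul_single, show (1 : ℤ) - (j + 1) = -j by ring]
      ring
    · simp

end KPHierarchy

end

theorem mainTheorem3 {K : Type*} [Field K] [CharZero K]
    (w ws : ℕ → KPHierarchy.TimeFn K) (hw : w 0 = 1) (hws : ws 0 = 1) :
    ((∃ S : KPHierarchy.BispecFn K,
        KPHierarchy.IsPotential (KPHierarchy.waveFn 1 w) (KPHierarchy.waveFn (-1) ws) S ∧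
        KPHierarchy.SpectralIdentity (KPHierarchy.waveFn 1 w) S ∧
        KPHierarchy.AdjointSpectralIdentity (KPHierarchy.waveFn (-1) ws) S) ↔
      KPHierarchy.HirotaIdentity (KPHierarchy.waveFn 1 w) (KPHierarchy.waveFn (-1) ws)) ∧
    (KPHierarchy.HirotaIdentity (KPHierarchy.waveFn 1 w) (KPHierarchy.waveFn (-1) ws) →
      KPHierarchy.IsBakerAkhiezerPair
        (KPHierarchy.waveFn 1 w) (KPHierarchy.waveFn (-1) ws)) := by
  rw [KPHierarchy.hirotaIdentity_iff]
  refine ⟨⟨fun ⟨S, hS, h1, _⟩ => KPHierarchy.ortho_of_spectralIdentity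
    (KPHierarchy.constantCoeff_specCoeff_waveFn 1 hw) hS h1, fun h =>
      KPHierarchy.exists_potential_of_ortho h
        (KPHierarchy.exists_reduced (KPHierarchy.exists_leading_waveFn 1 hw))
        (KPHierarchy.exists_reduced (KPHierarchy.exists_leading_waveFn (-1) hws))⟩,
    fun h => KPHierarchy.isBakerAkhiezerPair_of_ortho hw hws h⟩
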